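/- **Theorem ($q$-Cauchy formula and $q$-Stokes formula).** Let $m\ge 1$, $0<q<1$, $R>0$, and let $\mathbb{R}_{0,m}$ be the real Clifford algebra with generators $e_1,\dots,e_m$, $e_ie_j+e_je_i=-2\delta_{ij}$, and main anti-involution $\overline{\,\cdot\,}$ ($\overline{e_i}=-e_i$, $\overline{ab}=\overline{b}\,\overline{a}$). Write $\underline{x}=\sum_j x_je_j$, $\frac{1}{\underline{x}}=\underline{x}/\underline{x}^2=-\underline{x}/|x|^2$ for $x\neq0$, and for functions $f$ with values in $\mathbb{R}_{0,m}$ put $$\Gamma f=-\sum_{i<j}e_ie_j\,(x_i\partial_{x_j}f-x_j\partial_{x_i}f),\qquad q^\Gamma f=\sum_{n=0}^\infty\frac{(\ln q)^n}{n!}\,\Gamma^nf,\qquad (q^{\mathbb{E}}f)(\underline{x})=f(q\underline{x}),$$ $$[\mathbb{E}]_qf=\frac{q^{\mathbb{E}}f-f}{q-1},\qquad [\Gamma]_qf=\frac{q^\Gamma f-f}{q-1},\qquad \partial_{\underline{x}}^qf=\frac{1}{\underline{x}}\bigl([\mathbb{E}]_qf+q^{\mathbb{E}}[\Gamma]_qf\bigr)\quad(\underline{x}\ne0).$$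 We say that $q^\Gamma f$ is *defined* on a set $A\subset\mathbb{R}^m$ if $f$ is real analytic in a neighbourhood of $A$ and the series of $q^\Gamma f$ converges absolutely and uniformly on $A$ (that is, the series of the norms of its terms converges uniformly on $A$). Let $d\xi$ be the surface measure of the unit sphere $\mathbb{S}^{m-1}$ (counting measure on $\{\pm1\}$ if $m=1$), write $\int_{\partial\mathbb{B}^m(R)}d\xi\,F(\underline{x})=\int_{\mathbb{S}^{m-1}}d\xi\,F(R\,\underline{\xi})$, and define the $m$-dimensional $q$-integral by $$\int_{\mathbb{B}^m(R)}d_qV(\underline{x})\,F=\int_{\mathbb{S}^{m-1}}d\xi\int_0^Rd_qr\;r^{m-1}F(r\,\underline{\xi}),\qquad \int_0^a\varphi(t)\,d_qt=(1-q)\,a\sum_{k=0}^\infty\varphi(aq^k)\,q^k ;$$ it is said to exist if the inner series converges absolutely for every $\underline{\xi}\in\mathbb{S}^{m-1}$ and its sum is integrable over $\mathbb{S}^{m-1}$. (i) Let $f,g$ be $\mathbb{R}_{0,m}$-valued and real analytic in a neighbourhood of the closed ball $\mathbb{B}^m(R)$, such that $q^\Gamma f$ and $q^\Gamma g$ are defined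 on each sphere $\partial\mathbb{B}^m(q^{k+1}R)$ and $q^\Gamma\partial_{\underline{x}}^qf$ is defined on each sphere $\partial\mathbb{B}^m(q^{k}R)$, $k=0,1,2,\dots$. Then the $q$-integral below exists and $$\int_{\mathbb{B}^m(R)}d_qV(\underline{x})\,\Bigl[\overline{\bigl(q^{\Gamma}\partial_{\underline{x}}^qf\bigr)}\,g(q\underline{x})-\overline{f}\,(\partial_{\underline{x}}^qg)\Bigr]=R^{m-2}\int_{\partial\mathbb{B}^{m}(R)}d\xi\;\overline{f(\underline{x})}\,\underline{x}\,g(\underline{x}).$$ (ii) Let $g$ be $\mathbb{R}_{0,m}$-valued and real analytic in a neighbourhood of the closed ball $\mathbb{B}^m(R)$, such that $q^\Gamma g$ is defined on each sphere $\partial\mathbb{B}^m(q^{k+1}R)$, $k=0,1,2,\dots$. Then the $q$-integral below exists and $$\int_{\mathbb{B}^m(R)}d_qV(\underline{x})\,(\partial_{\underline{x}}^qg)=-R^{m-2}\int_{\partial\mathbb{B}^{m}(R)}d\xi\;\underline{x}\,g(\underline{x}).$$ -/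

import Mathlib

noncomputable section

namespace QClifford

/-- The quadratic form `x ↦ -‖x‖²` on `ℝᵐ`. -/
def negNormSq (m : ℕ) : QuadraticForm ℝ (EuclideanSpace ℝ (Fin m)) :=
  -LinearMap.BilinMap.toQuadraticMap (innerₗ (EuclideanSpace ℝ (Fin m)))

/-- The real Clifford algebra `ℝ_{0,m}`: `e i * e j + e j * e i = -2 δ i j`. -/
abbrev Cl (m : ℕ) : Type := CliffordAlgebra (negNormSq m)

/-- A vector `x = ∑ x_j e_j` as an element of the Clifford algebra (the vector variable). -/
def vec {m : ℕ} (x : EuclideanSpace ℝ (Fin m)) : Cl m := CliffordAlgebra.ι (negNormSq m) x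

/-- The generator `e_i`. -/
def e {m : ℕ} (i : Fin m) : Cl m := vec (EuclideanSpace.single i 1)

theorem vec_mul_vec {m : ℕ} (x : EuclideanSpace ℝ (Fin m)) :
    vec x * vec x = algebraMap ℝ (Cl m) (-‖x‖ ^ 2) := by
  rw [vec, CliffordAlgebra.ι_sq_scalar]
  congr 1
  simp [negNormSq]

theorem e_mul_e_add {m : ℕ} (i j : Fin m) :
    (e i * e j + e j * e i : Cl m) = algebraMap ℝ (Cl m) (if i = j then -2 else 0) := by
  rw [e, e, vec, vec, CliffordAlgebra.ι_mul_ι_add_swap]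
  congr 1
  by_cases h : i = j
  · subst h
    simp [negNormSq, QuadraticMap.polar, ← two_smul ℝ]
    norm_num
  · simp [negNormSq, QuadraticMap.polar, h, inner_add_right,
      EuclideanSpace.inner_single_left, Ne.symm h]

/-- The basis of the Clifford algebra indexed by subsets of the generators. -/
def clBasis (m : ℕ) : Module.Basis (Finset (Fin m)) ℝ (Cl m) :=
  (Module.Basis.ExteriorAlgebra (EuclideanSpace.basisFun (Fin m) ℝ).toBasis).map
    (CliffordAlgebra.equivExterior (negNormSq m)).symm

/-- The finite-dimensional space `ℝ_{0,m}` is normed by the largest coordinate in `clBasis`.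
All norms on it are equivalent; only the induced topology matters. -/
instance instNormedAddCommGroupCl (m : ℕ) : NormedAddCommGroup (Cl m) :=
  NormedAddCommGroup.induced (Cl m) (Finset (Fin m) → ℝ) (clBasis m).equivFun
    (clBasis m).equivFun.injective

instance instNormedSpaceCl (m : ℕ) : NormedSpace ℝ (Cl m) :=
  NormedSpace.induced ℝ (Cl m) (Finset (Fin m) → ℝ) (clBasis m).equivFun

instance instFiniteDimensionalCl (m : ℕ) : FiniteDimensional ℝ (Cl m) :=
  Module.Basis.finiteDimensional_of_finite (clBasis m)

/-- The partial derivative `∂_{x_j} f`. -/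
def pderiv {m : ℕ} (j : Fin m) (f : EuclideanSpace ℝ (Fin m) → Cl m)
    (x : EuclideanSpace ℝ (Fin m)) : Cl m :=
  fderiv ℝ f x (EuclideanSpace.single j 1)

/-- The Gamma operator `Γ = -∑_{i<j} e_i e_j (x_i ∂_{x_j} - x_j ∂_{x_i})`. -/
def Gam {m : ℕ} (f : EuclideanSpace ℝ (Fin m) → Cl m)
    (x : EuclideanSpace ℝ (Fin m)) : Cl m :=
  -∑ i, ∑ j, if i < j then e i * e j * (x i • pderiv j f x - x j • pderiv i f x) else 0

/-- The `n`-th term `(ln q)ⁿ / n! Γⁿ f` of the exponential series of `q^Γ f`. -/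
def qGammaTerm {m : ℕ} (q : ℝ) (f : EuclideanSpace ℝ (Fin m) → Cl m) (n : ℕ)
    (x : EuclideanSpace ℝ (Fin m)) : Cl m :=
  (Real.log q ^ n / (n.factorial : ℝ)) • (Gam^[n] f) x

/-- `q^Γ f = ∑ₙ (ln q)ⁿ / n! Γⁿ f`. -/
def qGamma {m : ℕ} (q : ℝ) (f : EuclideanSpace ℝ (Fin m) → Cl m)
    (x : EuclideanSpace ℝ (Fin m)) : Cl m :=
  ∑' n, qGammaTerm q f n x

/-- `q^Γ f` is defined on `A`: `f` is real analytic in a neighbourhood of `A` and the series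
of `q^Γ f` converges (unconditionally and) uniformly on `A`. -/
def QGammaDefinedOn {m : ℕ} (q : ℝ) (f : EuclideanSpace ℝ (Fin m) → Cl m)
    (A : Set (EuclideanSpace ℝ (Fin m))) : Prop :=
  AnalyticOnNhd ℝ f A ∧ SummableUniformlyOn (qGammaTerm q f) A

/-- `q^𝔼 f (x) = f (q x)`, with `𝔼` the Euler operator. -/
def qEuler {m : ℕ} (q : ℝ) (f : EuclideanSpace ℝ (Fin m) → Cl m)
    (x : EuclideanSpace ℝ (Fin m)) : Cl m :=
  f (q • x)

/-- `[T]_q f = (q^T f - f) / (q - 1)`, where `qT` is the operator `q^T`. -/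
def qBracket {m : ℕ} (q : ℝ)
    (qT : (EuclideanSpace ℝ (Fin m) → Cl m) → EuclideanSpace ℝ (Fin m) → Cl m)
    (f : EuclideanSpace ℝ (Fin m) → Cl m) (x : EuclideanSpace ℝ (Fin m)) : Cl m :=
  (q - 1)⁻¹ • (qT f x - f x)

/-- The inverse `x / x² = -x / ‖x‖²` of the vector variable, for `x ≠ 0`. -/
def vecInv {m : ℕ} (x : EuclideanSpace ℝ (Fin m)) : Cl m := (-(‖x‖ ^ 2))⁻¹ • vec x

theorem vec_mul_vecInv {m : ℕ} {x : EuclideanSpace ℝ (Fin m)} (hx : x ≠ 0) :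
    vec x * vecInv x = 1 := by
  rw [vecInv, mul_smul_comm, vec_mul_vec, Algebra.smul_def, ← map_mul]
  have h : ‖x‖ ≠ 0 := norm_ne_zero_iff.mpr hx
  rw [inv_mul_cancel₀ (by simpa using h), map_one]

/-- The `q`-Dirac operator `∂^q = x⁻¹ ([𝔼]_q + q^𝔼 [Γ]_q)`. -/
def qDirac {m : ℕ} (q : ℝ) (f : EuclideanSpace ℝ (Fin m) → Cl m)
    (x : EuclideanSpace ℝ (Fin m)) : Cl m :=
  vecInv x * (qBracket q (qEuler q) f x + qEuler q (qBracket q (qGamma q) f) x)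

/-- The Jackson `q`-integral `∫_0^a φ(t) d_q t = (1 - q) a ∑_k φ(a q^k) q^k`. -/
def jackson {m : ℕ} (q a : ℝ) (φ : ℝ → Cl m) : Cl m :=
  ((1 - q) * a) • ∑' k : ℕ, q ^ k • φ (a * q ^ k)

/-- The `m`-dimensional `q`-integral `∫_{𝕊^{m-1}} dξ ∫_0^R d_q r r^{m-1} F(rξ)`. -/
def qIntegral {m : ℕ} (q R : ℝ) (F : EuclideanSpace ℝ (Fin m) → Cl m) : Cl m :=
  ∫ ξ : Metric.sphere (0 : EuclideanSpace ℝ (Fin m)) 1,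
    jackson q R (fun r => r ^ (m - 1) • F (r • (ξ : EuclideanSpace ℝ (Fin m))))
    ∂(MeasureTheory.volume : MeasureTheory.Measure (EuclideanSpace ℝ (Fin m))).toSphere

/-- The `m`-dimensional `q`-integral of `F` exists: the inner Jackson series converges in every
direction `ξ` and the inner integral is integrable over the unit sphere. -/
def QIntegrable {m : ℕ} (q R : ℝ) (F : EuclideanSpace ℝ (Fin m) → Cl m) : Prop :=
  (∀ ξ : Metric.sphere (0 : EuclideanSpace ℝ (Fin m)) 1,
    Summable (fun k : ℕ => q ^ k •
      ((R * q ^ k) ^ (m - 1) • F ((R * q ^ k) • (ξ : EuclideanSpace ℝ (Fin m)))))) ∧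
  MeasureTheory.Integrable
    (fun ξ : Metric.sphere (0 : EuclideanSpace ℝ (Fin m)) 1 =>
      jackson q R (fun r => r ^ (m - 1) • F (r • (ξ : EuclideanSpace ℝ (Fin m)))))
    (MeasureTheory.volume : MeasureTheory.Measure (EuclideanSpace ℝ (Fin m))).toSphere

/-- `∫_{∂𝔹(R)} dξ F(x)`, with `dξ` the surface measure of the unit sphere and `x = R ξ`. -/
def sphereIntegral {m : ℕ} (R : ℝ) (F : EuclideanSpace ℝ (Fin m) → Cl m) : Cl m :=
  ∫ ξ : Metric.sphere (0 : EuclideanSpace ℝ (Fin m)) 1,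
    F (R • (ξ : EuclideanSpace ℝ (Fin m)))
    ∂(MeasureTheory.volume : MeasureTheory.Measure (EuclideanSpace ℝ (Fin m))).toSphere

end QClifford

end

/-!
Write `r_k = R q^k` and `x = r ξ` with `ξ` on the unit sphere. The two brackets in the `q`-Dirac
operator telescope to `∂^q g (x) = (q - 1)⁻¹ x⁻¹ ((q^Γ g)(q x) - g(x))` (`qDirac_eq`), so the
`q`-integral is a sum over `k` of integrals over the spheres of radius `r_k`, and the whole formula
is a telescoping sum once the following facts about the Gamma operator on a sphere are known.

* `Γ` is selfadjoint for the pairing `∫ \bar u v` (`integral_star_Gam_mul`). It is a combination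
  of derivatives along rotation fields with anti-selfadjoint bivector coefficients, and the
  derivative along a rotation field integrates to zero because the surface measure is rotation
  invariant (`integral_fderiv_skew`).
* `Γ x = x (m - 1 - Γ)` (`Gam_vec_mul`), which follows from `Γ = -x D - 𝔼` with the Dirac
  operator `D` and the Euler operator `𝔼`.

Expanding `q^Γ` in its series, which may be integrated termwise, the first fact shows that `q^Γ` is
selfadjoint (`integral_star_qGamma_mul`), and both together show
`∫ \bar{q^Γ u} x q^Γ v = q^{m-1} ∫ \bar u x v` (`integral_star_qGamma_mul_vec_mul_qGamma`): the
numbers `I a b = ∫ \bar{Γ^a u} x Γ^b v` satisfy `I (a + 1) b + I a (b + 1) = (m - 1) I a b`, so the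
double exponential series, summed along antidiagonals, is that of `exp ((m - 1) ln q) I 0 0`.
Hence the `k`-th term of the `q`-integral is `A_k - A_{k+1}` with
`A_k = r_k^{m-2} ∫ \bar f x g` over the sphere of radius `r_k` (`integral_integrand_eq_sub`), and
`A_k → 0` (`tendsto_boundaryPairing`).

The existence of the `q`-integral needs the integrand to be bounded near the origin. There `q^Γ`
acts on a power series degree by degree, with norm at most `b ^ k` in degree `k`, so `q^Γ f` is
again analytic at the origin (`hasFPowerSeriesAt_qGamma`). Since `∂^q f` is `|x|⁻²` times an
analytic function vanishing to second order, and `|x|⁻²` commutes with `Γ`, both `∂^q f` and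
`q^Γ ∂^q f` are bounded (`exists_bound_qDirac`).

The `q`-Stokes formula is the `q`-Cauchy formula for `f = -1`.
-/

noncomputable section

namespace QClifford

open Finset MeasureTheory Topology Metric

variable {m : ℕ}

/-! ### Smoothness of the Clifford operations, and the vector variable -/

instance instCompleteSpaceCl (m : ℕ) : CompleteSpace (Cl m) :=
  FiniteDimensional.complete ℝ (Cl m)

/-- Clifford multiplication as a continuous bilinear map. -/
def mulCLM (m : ℕ) : Cl m →L[ℝ] Cl m →L[ℝ] Cl m :=
  (LinearMap.mul ℝ (Cl m)).toContinuousBilinearMap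

@[simp]
theorem mulCLM_apply {m : ℕ} (a b : Cl m) : mulCLM m a b = a * b := rfl

/-- The main anti-involution as a continuous linear map. -/
def starCLM (m : ℕ) : Cl m →L[ℝ] Cl m :=
  LinearMap.toContinuousLinearMap
    { toFun := star
      map_add' := star_add
      map_smul' := fun c a => CliffordAlgebra.star_smul c a }

@[simp]
theorem starCLM_apply {m : ℕ} (a : Cl m) : starCLM m a = star a := rfl

/-- The inclusion of vectors as a continuous linear map. -/
def vecCLM (m : ℕ) : EuclideanSpace ℝ (Fin m) →L[ℝ] Cl m :=
  LinearMap.toContinuousLinearMap (CliffordAlgebra.ι (negNormSq m))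

@[simp]
theorem vecCLM_apply {m : ℕ} (x : EuclideanSpace ℝ (Fin m)) : vecCLM m x = vec x := rfl

instance instContinuousMulCl (m : ℕ) : ContinuousMul (Cl m) :=
  ⟨(mulCLM m).continuous₂⟩

instance instContinuousStarCl (m : ℕ) : ContinuousStar (Cl m) :=
  ⟨(starCLM m).continuous⟩

@[fun_prop]
theorem continuous_vec {m : ℕ} : Continuous (vec : EuclideanSpace ℝ (Fin m) → Cl m) :=
  (vecCLM m).continuous

/-- The norm is only submultiplicative up to a constant, since it is the largest coordinate. -/
theorem exists_norm_mul_le (m : ℕ) :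
    ∃ C : ℝ, 0 ≤ C ∧ ∀ a b : Cl m, ‖a * b‖ ≤ C * ‖a‖ * ‖b‖ :=
  ⟨‖mulCLM m‖, norm_nonneg (mulCLM m), fun a b => (mulCLM m).le_opNorm₂ a b⟩

theorem exists_norm_star_le (m : ℕ) :
    ∃ C : ℝ, 0 ≤ C ∧ ∀ a : Cl m, ‖star a‖ ≤ C * ‖a‖ :=
  ⟨‖starCLM m‖, norm_nonneg (starCLM m), fun a => (starCLM m).le_opNorm a⟩

section

variable {F : Type*} [NormedAddCommGroup F] [NormedSpace ℝ F] {u v : F → Cl m} {x : F}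

theorem analyticAt_mul (hu : AnalyticAt ℝ u x) (hv : AnalyticAt ℝ v x) :
    AnalyticAt ℝ (fun y => u y * v y) x :=
  ((mulCLM m).analyticAt_bilinear (u x, v x)).comp₂ hu hv

theorem analyticAt_star (hu : AnalyticAt ℝ u x) : AnalyticAt ℝ (fun y => star (u y)) x :=
  ((starCLM m).analyticAt _).comp hu

theorem fderiv_mul_apply (hu : DifferentiableAt ℝ u x) (hv : DifferentiableAt ℝ v x) (y : F) :
    fderiv ℝ (fun z => u z * v z) x y = u x * fderiv ℝ v x y + fderiv ℝ u x y * v x := by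
  have h := (mulCLM m).hasFDerivAt_of_bilinear hu.hasFDerivAt hv.hasFDerivAt
  have h' : fderiv ℝ (fun z => u z * v z) x = _ := h.fderiv
  rw [h']
  simp

theorem fderiv_star_apply (hu : DifferentiableAt ℝ u x) (y : F) :
    fderiv ℝ (fun z => star (u z)) x y = star (fderiv ℝ u x y) := by
  have h := (starCLM m).hasFDerivAt.comp x hu.hasFDerivAt
  have h' : fderiv ℝ (fun z => star (u z)) x = _ := h.fderiv
  rw [h']
  simp

end

theorem analyticAt_vec (x : EuclideanSpace ℝ (Fin m)) :
    AnalyticAt ℝ (vec : EuclideanSpace ℝ (Fin m) → Cl m) x :=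
  (vecCLM m).analyticAt x

theorem fderiv_vec (x y : EuclideanSpace ℝ (Fin m)) :
    fderiv ℝ (vec : EuclideanSpace ℝ (Fin m) → Cl m) x y = vec y := by
  have h : fderiv ℝ (vec : EuclideanSpace ℝ (Fin m) → Cl m) x = _ := (vecCLM m).hasFDerivAt.fderiv
  rw [h]
  simp

theorem vec_smul (c : ℝ) (x : EuclideanSpace ℝ (Fin m)) : vec (c • x) = c • vec x :=
  map_smul _ c x

theorem star_vec (x : EuclideanSpace ℝ (Fin m)) : star (vec x) = -vec x :=
  CliffordAlgebra.star_ι x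

theorem eq_sum_single (x : EuclideanSpace ℝ (Fin m)) :
    x = ∑ j, x j • EuclideanSpace.single j (1 : ℝ) := by
  conv_lhs => rw [← (EuclideanSpace.basisFun (Fin m) ℝ).sum_repr x]
  simp

theorem vec_eq_sum (x : EuclideanSpace ℝ (Fin m)) : vec x = ∑ j, x j • (e j : Cl m) := by
  conv_lhs => rw [eq_sum_single x, ← vecCLM_apply, map_sum]
  simp [e]

theorem fderiv_eq_sum_pderiv (f : EuclideanSpace ℝ (Fin m) → Cl m)
    (x y : EuclideanSpace ℝ (Fin m)) : fderiv ℝ f x y = ∑ j, y j • pderiv j f x := by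
  conv_lhs => rw [eq_sum_single y, map_sum]
  simp [pderiv]

theorem e_mul_e_of_ne {i j : Fin m} (h : i ≠ j) : (e i * e j : Cl m) = -(e j * e i) := by
  have := e_mul_e_add i j
  rw [if_neg h, map_zero] at this
  exact eq_neg_of_add_eq_zero_left this

theorem e_mul_self (i : Fin m) : (e i * e i : Cl m) = -1 := by
  rw [e, vec_mul_vec]
  simp

/-- `e_j x = -x e_j - 2 x_j`. -/
theorem e_mul_vec (j : Fin m) (x : EuclideanSpace ℝ (Fin m)) :
    e j * vec x = -(vec x * e j) - (2 * x j) • (1 : Cl m) := by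
  have h : e j * vec x + vec x * e j = -((2 * x j) • (1 : Cl m)) := by
    rw [vec_eq_sum, Finset.mul_sum, Finset.sum_mul, ← Finset.sum_add_distrib,
      Finset.sum_eq_single j]
    · rw [mul_smul_comm, smul_mul_assoc, e_mul_self]
      module
    · intro i _ hi
      rw [mul_smul_comm, smul_mul_assoc, e_mul_e_of_ne hi.symm]
      module
    · simp
  rw [sub_eq_add_neg, ← h]
  abel

/-! ### The Gamma operator -/

/-- The generator `x ↦ x_i e_j - x_j e_i` of the rotations in the `(i, j)`-plane. -/
def rot (i j : Fin m) : EuclideanSpace ℝ (Fin m) →L[ℝ] EuclideanSpace ℝ (Fin m) :=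
  (EuclideanSpace.proj i : EuclideanSpace ℝ (Fin m) →L[ℝ] ℝ).smulRight
      (EuclideanSpace.single j (1 : ℝ)) -
    (EuclideanSpace.proj j : EuclideanSpace ℝ (Fin m) →L[ℝ] ℝ).smulRight
      (EuclideanSpace.single i (1 : ℝ))

theorem rot_apply (i j : Fin m) (x : EuclideanSpace ℝ (Fin m)) :
    rot i j x = x i • EuclideanSpace.single j (1 : ℝ) - x j • EuclideanSpace.single i (1 : ℝ) := by
  simp [rot]

theorem inner_rot_left (i j : Fin m) (x y : EuclideanSpace ℝ (Fin m)) :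
    inner ℝ (rot i j x) y = -inner ℝ x (rot i j y) := by
  simp only [rot_apply, inner_sub_left, inner_sub_right, inner_smul_left, inner_smul_right,
    EuclideanSpace.inner_single_left, EuclideanSpace.inner_single_right]
  simp
  ring

/-- The coefficient of the rotation field `rot i j` in the Gamma operator. -/
def gamCoef (i j : Fin m) : Cl m := if i < j then -(e i * e j) else 0

/-- The bivector coefficients are anti-selfadjoint; together with the skewness of the rotation
fields this makes the Gamma operator selfadjoint on spheres. -/
theorem star_gamCoef (i j : Fin m) : star (gamCoef i j : Cl m) = -gamCoef i j := by
  unfold gamCoef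
  split_ifs with h
  · rw [star_neg, star_mul, e, e, star_vec, star_vec, neg_mul_neg]
    exact congrArg _ (e_mul_e_of_ne h.ne')
  · simp

theorem Gam_eq_sum_rot (f : EuclideanSpace ℝ (Fin m) → Cl m) (x : EuclideanSpace ℝ (Fin m)) :
    Gam f x = ∑ i, ∑ j, gamCoef i j * fderiv ℝ f x (rot i j x) := by
  unfold Gam
  rw [← Finset.sum_neg_distrib]
  refine Finset.sum_congr rfl fun i _ => ?_
  rw [← Finset.sum_neg_distrib]
  refine Finset.sum_congr rfl fun j _ => ?_
  unfold gamCoef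
  split_ifs
  · simp only [rot_apply, pderiv, mul_sub, map_sub, map_smul, mul_smul_comm, neg_mul, smul_neg]
    abel
  · simp

/-- `Γ = -x D - 𝔼` with the Dirac operator `D = ∑ e_j ∂_j` and the Euler operator `𝔼`. -/
theorem Gam_eq_dirac (f : EuclideanSpace ℝ (Fin m) → Cl m) (x : EuclideanSpace ℝ (Fin m)) :
    Gam f x = -(vec x * ∑ j, e j * pderiv j f x) - fderiv ℝ f x x := by
  have hsplit : (∑ i, ∑ j, if i < j then e i * e j * (x i • pderiv j f x - x j • pderiv i f x)
      else 0) = ∑ i, ∑ j, (if i < j then x i • (e i * e j * pderiv j f x) else 0)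
        + ∑ i, ∑ j, (if j < i then x i • (e i * e j * pderiv j f x) else 0) := by
    -- exchange the names of `i` and `j` in the second summand and use `e_i e_j = -e_j e_i`
    rw [Finset.sum_comm (f := fun i j => if j < i then x i • (e i * e j * pderiv j f x) else 0)]
    rw [← Finset.sum_add_distrib]
    refine Finset.sum_congr rfl fun i _ => ?_
    rw [← Finset.sum_add_distrib]
    refine Finset.sum_congr rfl fun j _ => ?_
    split_ifs with h
    · rw [e_mul_e_of_ne h.ne', mul_sub, mul_smul_comm, mul_smul_comm, neg_mul, smul_neg,
        sub_eq_add_neg]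
    · simp
  have hdirac : vec x * ∑ j, e j * pderiv j f x
      = ∑ i, ∑ j, x i • (e i * e j * pderiv j f x) := by
    rw [vec_eq_sum, Finset.sum_mul]
    refine Finset.sum_congr rfl fun i _ => ?_
    rw [Finset.mul_sum]
    refine Finset.sum_congr rfl fun j _ => ?_
    rw [smul_mul_assoc, mul_assoc]
  have hdiag : fderiv ℝ f x x
      = -∑ i, ∑ j, if i = j then x i • (e i * e j * pderiv j f x) else 0 := by
    rw [fderiv_eq_sum_pderiv, ← Finset.sum_neg_distrib]
    refine Finset.sum_congr rfl fun i _ => ?_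
    rw [Finset.sum_ite_eq]
    simp [e_mul_self]
  unfold Gam
  rw [hsplit, hdirac, hdiag, ← Finset.sum_add_distrib, sub_neg_eq_add, ← Finset.sum_neg_distrib,
    ← Finset.sum_neg_distrib, ← Finset.sum_add_distrib]
  refine Finset.sum_congr rfl fun i _ => ?_
  rw [← Finset.sum_neg_distrib, ← Finset.sum_add_distrib, ← Finset.sum_neg_distrib,
    ← Finset.sum_add_distrib]
  refine Finset.sum_congr rfl fun j _ => ?_
  rcases lt_trichotomy i j with h | h | h
  · simp [h, h.ne, h.not_gt]
  · simp [h]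
  · simp [h, h.ne', h.not_gt]

/-- Multiplication by the vector variable intertwines `Γ` with `m - 1 - Γ`. -/
theorem Gam_vec_mul {v : EuclideanSpace ℝ (Fin m) → Cl m} {x : EuclideanSpace ℝ (Fin m)}
    (hv : DifferentiableAt ℝ v x) :
    Gam (fun y => vec y * v y) x = vec x * (((m : ℝ) - 1) • v x - Gam v x) := by
  have hd : ∀ y, fderiv ℝ (fun z => vec z * v z) x y = vec x * fderiv ℝ v x y + vec y * v x := by
    intro y
    rw [fderiv_mul_apply (analyticAt_vec x).differentiableAt hv, fderiv_vec]
  have hD : ∑ j, e j * pderiv j (fun z => vec z * v z) x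
      = -(vec x * ∑ j, e j * pderiv j v x) - (2 : ℝ) • fderiv ℝ v x x - (m : ℝ) • v x := by
    have h1 : ∀ j : Fin m, e j * pderiv j (fun z => vec z * v z) x
        = -(vec x * (e j * pderiv j v x)) - (2 : ℝ) • (x j • pderiv j v x) - v x := by
      intro j
      rw [pderiv, hd, mul_add, ← mul_assoc, ← mul_assoc, e_mul_vec, sub_mul, neg_mul, mul_assoc]
      change _ + e j * e j * v x = _
      rw [e_mul_self, smul_mul_assoc, one_mul, mul_smul, neg_mul, one_mul, ← sub_eq_add_neg]
      rfl
    simp only [h1, Finset.sum_sub_distrib, Finset.sum_neg_distrib]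
    rw [← Finset.mul_sum, ← Finset.smul_sum, ← fderiv_eq_sum_pderiv, Finset.sum_const,
      Finset.card_univ, Fintype.card_fin, Nat.cast_smul_eq_nsmul]
  rw [Gam_eq_dirac, hD, hd, Gam_eq_dirac v]
  simp only [mul_sub, mul_neg, mul_smul_comm]
  module

/-! ### Iterates of the Gamma operator: analyticity, scaling, radial factors -/

theorem analyticAt_fderiv_apply {f : EuclideanSpace ℝ (Fin m) → Cl m}
    {x : EuclideanSpace ℝ (Fin m)} (hf : AnalyticAt ℝ f x)
    (A : EuclideanSpace ℝ (Fin m) →L[ℝ] EuclideanSpace ℝ (Fin m)) :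
    AnalyticAt ℝ (fun y => fderiv ℝ f y (A y)) x :=
  ((ContinuousLinearMap.id ℝ (EuclideanSpace ℝ (Fin m) →L[ℝ] Cl m)).analyticAt_bilinear
    (fderiv ℝ f x, A x)).comp₂ hf.fderiv (A.analyticAt x)

theorem analyticAt_Gam {f : EuclideanSpace ℝ (Fin m) → Cl m} {x : EuclideanSpace ℝ (Fin m)}
    (hf : AnalyticAt ℝ f x) : AnalyticAt ℝ (Gam f) x := by
  rw [show Gam f = fun y => ∑ i, ∑ j, gamCoef i j * fderiv ℝ f y (rot i j y) from
    funext (Gam_eq_sum_rot f)]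
  refine Finset.analyticAt_fun_sum _ fun i _ => Finset.analyticAt_fun_sum _ fun j _ => ?_
  exact analyticAt_mul analyticAt_const (analyticAt_fderiv_apply hf _)

theorem analyticAt_Gam_iterate {f : EuclideanSpace ℝ (Fin m) → Cl m}
    {x : EuclideanSpace ℝ (Fin m)} (hf : AnalyticAt ℝ f x) (n : ℕ) :
    AnalyticAt ℝ (Gam^[n] f) x := by
  induction n with
  | zero => exact hf
  | succ n ih =>
    rw [Function.iterate_succ_apply']
    exact analyticAt_Gam ih

theorem Gam_congr {f g : EuclideanSpace ℝ (Fin m) → Cl m} {x : EuclideanSpace ℝ (Fin m)}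
    (h : f =ᶠ[𝓝 x] g) : Gam f =ᶠ[𝓝 x] Gam g := by
  filter_upwards [h.fderiv (𝕜 := ℝ)] with y hy
  rw [Gam_eq_sum_rot, Gam_eq_sum_rot, hy]

theorem Gam_comp_smul (c : ℝ) (f : EuclideanSpace ℝ (Fin m) → Cl m) :
    Gam (fun y => f (c • y)) = fun y => Gam f (c • y) := by
  funext x
  rw [Gam_eq_sum_rot, Gam_eq_sum_rot]
  have h : fderiv ℝ (fun y => f (c • y)) x = c • fderiv ℝ f (c • x) := fderiv_comp_smul ..
  simp [h]

theorem Gam_iterate_comp_smul (c : ℝ) (f : EuclideanSpace ℝ (Fin m) → Cl m) (n : ℕ) :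
    Gam^[n] (fun y => f (c • y)) = fun y => (Gam^[n] f) (c • y) := by
  induction n with
  | zero => rfl
  | succ n ih => rw [Function.iterate_succ_apply', ih, Gam_comp_smul, Function.iterate_succ_apply']

theorem Gam_const (c : Cl m) : Gam (fun _ : EuclideanSpace ℝ (Fin m) => c) = fun _ => 0 := by
  funext x
  simp [Gam_eq_sum_rot]

theorem Gam_iterate_succ_const (c : Cl m) (n : ℕ) :
    Gam^[n + 1] (fun _ : EuclideanSpace ℝ (Fin m) => c) = fun _ => 0 := by
  induction n with
  | zero => exact Gam_const c
  | succ n ih => rw [Function.iterate_succ_apply', ih, Gam_const]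

/-- A scalar function that is constant along rotations commutes with the Gamma operator. -/
theorem Gam_smul_of_rot_eq_zero {ψ : EuclideanSpace ℝ (Fin m) → ℝ}
    {f : EuclideanSpace ℝ (Fin m) → Cl m} {x : EuclideanSpace ℝ (Fin m)}
    (hψ : DifferentiableAt ℝ ψ x) (hrot : ∀ i j, fderiv ℝ ψ x (rot i j x) = 0)
    (hf : DifferentiableAt ℝ f x) :
    Gam (fun y => ψ y • f y) x = ψ x • Gam f x := by
  rw [Gam_eq_sum_rot, Gam_eq_sum_rot, Finset.smul_sum]
  refine Finset.sum_congr rfl fun i _ => ?_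
  rw [Finset.smul_sum]
  refine Finset.sum_congr rfl fun j _ => ?_
  rw [fderiv_fun_smul hψ hf]
  simp [hrot]

theorem differentiableAt_norm_sq_inv {x : EuclideanSpace ℝ (Fin m)} (hx : x ≠ 0) :
    DifferentiableAt ℝ (fun y : EuclideanSpace ℝ (Fin m) => (‖y‖ ^ 2)⁻¹) x := by
  have h : ‖x‖ ^ 2 ≠ 0 := by simpa using hx
  exact (differentiableAt_id.norm_sq ℝ).inv h

theorem fderiv_norm_sq_inv_rot {x : EuclideanSpace ℝ (Fin m)} (hx : x ≠ 0) (i j : Fin m) :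
    fderiv ℝ (fun y : EuclideanSpace ℝ (Fin m) => (‖y‖ ^ 2)⁻¹) x (rot i j x) = 0 := by
  have h : ‖x‖ ^ 2 ≠ 0 := by simpa using hx
  have hin : inner ℝ x (rot i j x) = 0 := by
    have := inner_rot_left i j x x
    rw [real_inner_comm] at this
    linarith
  have hd := (hasDerivAt_inv h).comp_hasFDerivAt x (hasStrictFDerivAt_norm_sq x).hasFDerivAt
  have hd' : fderiv ℝ (fun y : EuclideanSpace ℝ (Fin m) => (‖y‖ ^ 2)⁻¹) x = _ := hd.fderiv
  rw [hd']
  simp [hin]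

/-- The radial factor `|x|⁻²` commutes with all iterates of the Gamma operator away from the
origin. -/
theorem Gam_iterate_norm_sq_inv_smul {f : EuclideanSpace ℝ (Fin m) → Cl m}
    {U : Set (EuclideanSpace ℝ (Fin m))} (hU : IsOpen U) (h0 : (0 : EuclideanSpace ℝ (Fin m)) ∉ U)
    (hf : AnalyticOnNhd ℝ f U) (n : ℕ) :
    ∀ x ∈ U, (Gam^[n] fun y => (‖y‖ ^ 2)⁻¹ • f y) x = (‖x‖ ^ 2)⁻¹ • (Gam^[n] f) x := by
  induction n with
  | zero => intro x _; rfl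
  | succ n ih =>
    intro x hx
    have hx0 : x ≠ 0 := fun h => h0 (h ▸ hx)
    rw [Function.iterate_succ_apply', Function.iterate_succ_apply']
    have hloc : (Gam^[n] fun y => (‖y‖ ^ 2)⁻¹ • f y) =ᶠ[𝓝 x]
        fun y => (‖y‖ ^ 2)⁻¹ • (Gam^[n] f) y := by
      filter_upwards [hU.mem_nhds hx] with y hy using ih y hy
    rw [(Gam_congr hloc).eq_of_nhds]
    exact Gam_smul_of_rot_eq_zero (differentiableAt_norm_sq_inv hx0)
      (fderiv_norm_sq_inv_rot hx0) (analyticAt_Gam_iterate (hf x hx) n).differentiableAt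

/-! ### Rotation invariance of the surface measure -/

/-- The surface measure of the unit sphere of `ℝᵐ`. -/
abbrev sphereMeasure (m : ℕ) : Measure (sphere (0 : EuclideanSpace ℝ (Fin m)) 1) :=
  (volume : Measure (EuclideanSpace ℝ (Fin m))).toSphere

/-- The action of a linear isometry on the unit sphere. -/
def sphereMap (A : EuclideanSpace ℝ (Fin m) ≃ₗᵢ[ℝ] EuclideanSpace ℝ (Fin m))
    (ξ : sphere (0 : EuclideanSpace ℝ (Fin m)) 1) : sphere (0 : EuclideanSpace ℝ (Fin m)) 1 :=
  ⟨A ξ, by simp⟩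

open scoped Pointwise in
theorem measurePreserving_sphereMap
    (A : EuclideanSpace ℝ (Fin m) ≃ₗᵢ[ℝ] EuclideanSpace ℝ (Fin m)) :
    MeasurePreserving (sphereMap A) (sphereMeasure m) (sphereMeasure m) := by
  have hmeas : Measurable (sphereMap A) :=
    (Continuous.subtype_mk (A.continuous.comp continuous_subtype_val) _).measurable
  refine ⟨hmeas, Measure.ext fun s hs => ?_⟩
  rw [Measure.map_apply hmeas hs, Measure.toSphere_apply' _ (hmeas hs),
    Measure.toSphere_apply' _ hs]
  congr 1
  rw [← MeasurePreserving.measure_preimage_equiv (f := A.toMeasurableEquiv) A.measurePreserving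
    (Set.Ioo (0 : ℝ) 1 • (Subtype.val '' s))]
  congr 1
  ext x
  simp only [Set.mem_smul, Set.mem_image, Set.mem_preimage, Set.mem_Ioo]
  constructor
  · rintro ⟨c, hc, _, ⟨ξ, hξ, rfl⟩, rfl⟩
    exact ⟨c, hc, _, ⟨sphereMap A ξ, hξ, rfl⟩, by simp [sphereMap]⟩
  · rintro ⟨c, hc, _, ⟨ξ, hξ, rfl⟩, h⟩
    refine ⟨c, hc, _, ⟨sphereMap A.symm ξ, ?_, rfl⟩, ?_⟩
    · have : sphereMap A (sphereMap A.symm ξ) = ξ := by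
        ext1
        simp [sphereMap]
      rw [this]
      exact hξ
    · apply A.injective
      rw [map_smul]
      simpa [sphereMap] using h

theorem integral_sphere_comp_isometry (A : EuclideanSpace ℝ (Fin m) ≃ₗᵢ[ℝ] EuclideanSpace ℝ (Fin m))
    {φ : EuclideanSpace ℝ (Fin m) → Cl m}
    (hφ : Continuous fun ξ : sphere (0 : EuclideanSpace ℝ (Fin m)) 1 => φ ξ) :
    ∫ ξ, φ (A ξ) ∂sphereMeasure m = ∫ ξ, φ ξ ∂sphereMeasure m := by
  have h := (measurePreserving_sphereMap A).map_eq
  conv_rhs => rw [← h]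
  rw [integral_map (measurePreserving_sphereMap A).aemeasurable hφ.aestronglyMeasurable]
  rfl

theorem integrable_sphere_of_continuous
    {F : sphere (0 : EuclideanSpace ℝ (Fin m)) 1 → Cl m} (hF : Continuous F) :
    Integrable F (sphereMeasure m) :=
  hF.integrable_of_hasCompactSupport (HasCompactSupport.of_compactSpace F)

theorem integral_vec_sphere : ∫ ξ, vec ξ.1 ∂sphereMeasure m = (0 : Cl m) := by
  have h := integral_sphere_comp_isometry (LinearIsometryEquiv.neg ℝ) (φ := vec (m := m))
    (by fun_prop)
  have h2 : ∀ x : EuclideanSpace ℝ (Fin m), vec (-x) = -vec x := fun x => map_neg _ x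
  simp only [LinearIsometryEquiv.coe_neg, h2] at h
  rw [integral_neg] at h
  have h3 : (2 : ℝ) • ∫ ξ, vec ξ.1 ∂sphereMeasure m = (0 : Cl m) := by
    rw [two_smul]
    nth_rw 1 [← h]
    exact neg_add_cancel _
  exact (smul_eq_zero.mp h3).resolve_left two_ne_zero

theorem smul_mem_sphere {r : ℝ} (hr : 0 ≤ r) (ξ : sphere (0 : EuclideanSpace ℝ (Fin m)) 1) :
    r • (ξ : EuclideanSpace ℝ (Fin m)) ∈ sphere (0 : EuclideanSpace ℝ (Fin m)) r := by
  simp [norm_smul, abs_of_nonneg hr]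

theorem continuous_comp_smul_sphere {r : ℝ} (hr : 0 ≤ r) {f : EuclideanSpace ℝ (Fin m) → Cl m}
    (hf : ContinuousOn f (sphere 0 r)) :
    Continuous fun ξ : sphere (0 : EuclideanSpace ℝ (Fin m)) 1 =>
      f (r • (ξ : EuclideanSpace ℝ (Fin m))) :=
  hf.comp_continuous (by fun_prop) (smul_mem_sphere hr)

/-- The derivative along a skew field integrates to zero over each sphere, because the flow
`exp (t A)` of the field is orthogonal. -/
theorem integral_fderiv_skew {r : ℝ} (hr : 0 ≤ r)
    {A : EuclideanSpace ℝ (Fin m) →L[ℝ] EuclideanSpace ℝ (Fin m)}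
    (hA : ∀ x y, inner ℝ (A x) y = -inner ℝ x (A y))
    {w : EuclideanSpace ℝ (Fin m) → Cl m} (hw : AnalyticOnNhd ℝ w (sphere 0 r)) :
    ∫ ξ, fderiv ℝ w (r • ξ.1) (A (r • ξ.1)) ∂sphereMeasure m = 0 := by
  -- the operator exponential is defined for algebras over `ℚ`
  let +nondep : NormedAlgebra ℚ (EuclideanSpace ℝ (Fin m) →L[ℝ] EuclideanSpace ℝ (Fin m)) :=
    .restrictScalars ℚ ℝ _
  have hskew : A ∈ skewAdjoint (EuclideanSpace ℝ (Fin m) →L[ℝ] EuclideanSpace ℝ (Fin m)) := by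
    rw [skewAdjoint.mem_iff, ContinuousLinearMap.star_eq_adjoint]
    symm
    rw [ContinuousLinearMap.eq_adjoint_iff]
    intro x y
    simp [hA]
  have hunit : ∀ t : ℝ, NormedSpace.exp (t • A) ∈
      unitary (EuclideanSpace ℝ (Fin m) →L[ℝ] EuclideanSpace ℝ (Fin m)) := fun t =>
    NormedSpace.exp_mem_unitary_of_mem_skewAdjoint (skewAdjoint.smul_mem t hskew)
  let Φ : ℝ → EuclideanSpace ℝ (Fin m) ≃ₗᵢ[ℝ] EuclideanSpace ℝ (Fin m) := fun t =>
    Unitary.linearIsometryEquiv ⟨_, hunit t⟩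
  have hΦ : ∀ t x, Φ t x = NormedSpace.exp (t • A) x := fun t x => rfl
  have hΦd : ∀ t x, HasDerivAt (fun s => Φ s x) (A (Φ t x)) t := by
    intro t x
    have h := (hasDerivAt_exp_smul_const' (𝕂 := ℝ) A t).clm_apply (hasDerivAt_const t x)
    simpa [hΦ] using h
  have hwc : ContinuousOn w (sphere 0 r) := hw.continuousOn
  have hdc : ContinuousOn (fun x => fderiv ℝ w x (A x)) (sphere 0 r) := fun x hx =>
    (analyticAt_fderiv_apply (hw x hx) A).continuousAt.continuousWithinAt
  obtain ⟨C, hC⟩ := (isCompact_sphere (0 : EuclideanSpace ℝ (Fin m)) r).exists_bound_of_continuousOn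
    hdc
  have hmem : ∀ t (ξ : sphere (0 : EuclideanSpace ℝ (Fin m)) 1),
      Φ t (r • ξ.1) ∈ sphere (0 : EuclideanSpace ℝ (Fin m)) r := by
    intro t ξ
    rw [mem_sphere_zero_iff_norm, LinearIsometryEquiv.norm_map]
    exact mem_sphere_zero_iff_norm.mp (smul_mem_sphere hr ξ)
  have hΦ0 : ∀ x, Φ 0 x = x := by
    intro x
    rw [hΦ, zero_smul ℝ A, NormedSpace.exp_zero]
    rfl
  have hcont : ∀ t, Continuous fun ξ : sphere (0 : EuclideanSpace ℝ (Fin m)) 1 =>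
      w (Φ t (r • ξ.1)) := fun t =>
    hwc.comp_continuous ((Φ t).continuous.comp (by fun_prop)) (hmem t)
  have hcont' : ∀ t, Continuous fun ξ : sphere (0 : EuclideanSpace ℝ (Fin m)) 1 =>
      fderiv ℝ w (Φ t (r • ξ.1)) (A (Φ t (r • ξ.1))) := fun t =>
    hdc.comp_continuous ((Φ t).continuous.comp (by fun_prop)) (hmem t)
  have hkey := (hasDerivAt_integral_of_dominated_loc_of_deriv_le (μ := sphereMeasure m)
    (F := fun (t : ℝ) ξ => w (Φ t (r • ξ.1)))
    (F' := fun (t : ℝ) ξ => fderiv ℝ w (Φ t (r • ξ.1)) (A (Φ t (r • ξ.1))))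
    (bound := fun _ => C) (x₀ := (0 : ℝ)) (s := Set.univ) Filter.univ_mem
    (Filter.Eventually.of_forall fun t => (hcont t).aestronglyMeasurable)
    (integrable_sphere_of_continuous (hcont 0)) (hcont' 0).aestronglyMeasurable
    (Filter.Eventually.of_forall fun ξ t _ => hC _ (hmem t ξ)) (integrable_const C)
    (Filter.Eventually.of_forall fun ξ t _ =>
      (hw _ (hmem t ξ)).differentiableAt.hasFDerivAt.comp_hasDerivAt t (hΦd t _))).2
  -- by rotation invariance, the integral does not change along the flow
  have hconst : (fun t : ℝ => ∫ ξ, w (Φ t (r • ξ.1)) ∂sphereMeasure m)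
      = fun _ => ∫ ξ, w (r • ξ.1) ∂sphereMeasure m := by
    funext t
    have h := integral_sphere_comp_isometry (Φ t) (φ := fun x => w (r • x))
      (continuous_comp_smul_sphere hr hwc)
    simpa using h
  rw [hconst] at hkey
  have h0 := hkey.unique (hasDerivAt_const _ _)
  simpa only [hΦ0] using h0

/-- The Gamma operator is selfadjoint on each sphere. -/
theorem integral_star_Gam_mul {r : ℝ} (hr : 0 ≤ r) {u v : EuclideanSpace ℝ (Fin m) → Cl m}
    (hu : AnalyticOnNhd ℝ u (sphere 0 r)) (hv : AnalyticOnNhd ℝ v (sphere 0 r)) :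
    ∫ ξ, star (Gam u (r • ξ.1)) * v (r • ξ.1) ∂sphereMeasure m
      = ∫ ξ, star (u (r • ξ.1)) * Gam v (r • ξ.1) ∂sphereMeasure m := by
  have hGc : ∀ {f : EuclideanSpace ℝ (Fin m) → Cl m}, AnalyticOnNhd ℝ f (sphere 0 r) →
      Continuous fun ξ : sphere (0 : EuclideanSpace ℝ (Fin m)) 1 => f (r • ξ.1) := fun hf =>
    continuous_comp_smul_sphere hr hf.continuousOn
  have hGu : AnalyticOnNhd ℝ (Gam u) (sphere 0 r) := fun x hx => analyticAt_Gam (hu x hx)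
  have hGv : AnalyticOnNhd ℝ (Gam v) (sphere 0 r) := fun x hx => analyticAt_Gam (hv x hx)
  have hw : ∀ i j : Fin m, AnalyticOnNhd ℝ (fun x => star (u x) * (gamCoef i j * v x))
      (sphere 0 r) := fun i j x hx =>
    analyticAt_mul (analyticAt_star (hu x hx)) (analyticAt_mul analyticAt_const (hv x hx))
  have hpt : ∀ x ∈ sphere (0 : EuclideanSpace ℝ (Fin m)) r,
      star (u x) * Gam v x - star (Gam u x) * v x
        = ∑ i, ∑ j, fderiv ℝ (fun x => star (u x) * (gamCoef i j * v x)) x (rot i j x) := by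
    intro x hx
    rw [Gam_eq_sum_rot, Gam_eq_sum_rot, star_sum, Finset.sum_mul, Finset.mul_sum,
      ← Finset.sum_sub_distrib]
    refine Finset.sum_congr rfl fun i _ => ?_
    rw [star_sum, Finset.sum_mul, Finset.mul_sum, ← Finset.sum_sub_distrib]
    refine Finset.sum_congr rfl fun j _ => ?_
    have hud := (hu x hx).differentiableAt
    have hvd := (hv x hx).differentiableAt
    have hcv : fderiv ℝ (fun x => gamCoef i j * v x) x (rot i j x)
        = gamCoef i j * fderiv ℝ v x (rot i j x) := by
      rw [fderiv_mul_apply (differentiableAt_const _) hvd]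
      simp
    rw [fderiv_mul_apply (analyticAt_star (hu x hx)).differentiableAt
      (analyticAt_mul analyticAt_const (hv x hx)).differentiableAt, fderiv_star_apply hud, hcv,
      star_mul, star_gamCoef, mul_neg, neg_mul, sub_neg_eq_add, mul_assoc]
  have hc1 : Continuous fun ξ : sphere (0 : EuclideanSpace ℝ (Fin m)) 1 =>
      star (u (r • ξ.1)) * Gam v (r • ξ.1) := (hGc hu).star.mul (hGc hGv)
  have hc2 : Continuous fun ξ : sphere (0 : EuclideanSpace ℝ (Fin m)) 1 =>
      star (Gam u (r • ξ.1)) * v (r • ξ.1) := (hGc hGu).star.mul (hGc hv)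
  symm
  rw [← sub_eq_zero, ← integral_sub (integrable_sphere_of_continuous hc1)
    (integrable_sphere_of_continuous hc2)]
  have hint : ∀ i j : Fin m, Integrable (fun ξ : sphere (0 : EuclideanSpace ℝ (Fin m)) 1 =>
      fderiv ℝ (fun x => star (u x) * (gamCoef i j * v x)) (r • ξ.1) (rot i j (r • ξ.1)))
      (sphereMeasure m) := fun i j =>
    integrable_sphere_of_continuous (continuous_comp_smul_sphere hr
      (f := fun x => fderiv ℝ (fun x => star (u x) * (gamCoef i j * v x)) x (rot i j x))
      fun x hx => (analyticAt_fderiv_apply (hw i j x hx) _).continuousAt.continuousWithinAt)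
  calc ∫ ξ : sphere (0 : EuclideanSpace ℝ (Fin m)) 1, star (u (r • ξ.1)) * Gam v (r • ξ.1)
        - star (Gam u (r • ξ.1)) * v (r • ξ.1) ∂sphereMeasure m
      = ∫ ξ : sphere (0 : EuclideanSpace ℝ (Fin m)) 1, ∑ i, ∑ j,
          fderiv ℝ (fun x => star (u x) * (gamCoef i j * v x)) (r • ξ.1) (rot i j (r • ξ.1))
          ∂sphereMeasure m :=
        integral_congr_ae (Filter.Eventually.of_forall fun ξ => hpt _ (smul_mem_sphere hr ξ))
    _ = 0 := by
        rw [integral_finsetSum _ fun i _ => integrable_finsetSum _ fun j _ => hint i j]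
        refine Finset.sum_eq_zero fun i _ => ?_
        rw [integral_finsetSum _ fun j _ => hint i j]
        exact Finset.sum_eq_zero fun j _ => integral_fderiv_skew hr (inner_rot_left i j) (hw i j)

/-! ### Termwise integration of the series `q^Γ f` over spheres -/

theorem sum_abs_le_of_sum_le {ι : Type*} {b : ι → ℝ} {C : ℝ} (s : Finset ι)
    (h : ∀ t : Finset ι, |∑ i ∈ t, b i| ≤ C) : ∑ i ∈ s, |b i| ≤ 2 * C := by
  classical
  rw [← Finset.sum_filter_add_sum_filter_not s (fun i => 0 ≤ b i)]
  have h1 : ∑ i ∈ s.filter (fun i => 0 ≤ b i), |b i| ≤ C := by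
    rw [Finset.sum_congr rfl fun i hi => abs_of_nonneg (Finset.mem_filter.mp hi).2]
    exact (le_abs_self _).trans (h _)
  have h2 : ∑ i ∈ s.filter (fun i => ¬ 0 ≤ b i), |b i| ≤ C := by
    rw [Finset.sum_congr rfl fun i hi =>
      abs_of_neg (not_le.mp (Finset.mem_filter.mp hi).2), Finset.sum_neg_distrib]
    exact (neg_le_abs _).trans (h _)
  linarith

/-- In the finite-dimensional algebra, a family all of whose finite partial sums are bounded is
absolutely summable, with a bound that depends on the partial sums only. -/
theorem sum_norm_le_of_norm_sum_le {ι : Type*} {a : ι → Cl m} {C : ℝ} (s : Finset ι)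
    (h : ∀ t : Finset ι, ‖∑ i ∈ t, a i‖ ≤ C) :
    ∑ i ∈ s, ‖a i‖ ≤ Fintype.card (Finset (Fin m)) * (2 * C) := by
  have hcoord : ∀ (x : Cl m) J, |(clBasis m).equivFun x J| ≤ ‖x‖ := fun x J =>
    norm_le_pi_norm ((clBasis m).equivFun x) J
  have hnorm : ∀ x : Cl m, ‖x‖ ≤ ∑ J, |(clBasis m).equivFun x J| := fun x =>
    (pi_norm_le_iff_of_nonneg (Finset.sum_nonneg fun _ _ => abs_nonneg _)).mpr fun J =>
      Finset.single_le_sum (f := fun J => |(clBasis m).equivFun x J|)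
        (fun _ _ => abs_nonneg _) (Finset.mem_univ J)
  calc ∑ i ∈ s, ‖a i‖ ≤ ∑ i ∈ s, ∑ J, |(clBasis m).equivFun (a i) J| :=
        Finset.sum_le_sum fun i _ => hnorm _
    _ = ∑ J, ∑ i ∈ s, |(clBasis m).equivFun (a i) J| := Finset.sum_comm
    _ ≤ ∑ _J : Finset (Fin m), 2 * C := by
        refine Finset.sum_le_sum fun J _ => sum_abs_le_of_sum_le s fun t => ?_
        have := (hcoord (∑ i ∈ t, a i) J).trans (h t)
        rwa [map_sum, Finset.sum_apply] at this
    _ = Fintype.card (Finset (Fin m)) * (2 * C) := by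
        rw [Finset.sum_const, Finset.card_univ, nsmul_eq_mul]

/-- The usable content of `QGammaDefinedOn` on a sphere: the sum is continuous and the sums of
the norms of the terms are bounded uniformly over the sphere. -/
structure QGammaRegular (q : ℝ) (f : EuclideanSpace ℝ (Fin m) → Cl m) (r : ℝ) : Prop where
  analyticOnNhd : AnalyticOnNhd ℝ f (sphere 0 r)
  continuousOn : ContinuousOn (qGamma q f) (sphere 0 r)
  bounded : ∃ B : ℝ, ∀ x ∈ sphere (0 : EuclideanSpace ℝ (Fin m)) r, ∀ s : Finset ℕ,
    ∑ n ∈ s, ‖qGammaTerm q f n x‖ ≤ B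

theorem continuousOn_qGammaTerm {q r : ℝ} {f : EuclideanSpace ℝ (Fin m) → Cl m}
    (hf : AnalyticOnNhd ℝ f (sphere 0 r)) (n : ℕ) :
    ContinuousOn (qGammaTerm q f n) (sphere 0 r) := fun x hx =>
  ((analyticAt_Gam_iterate (hf x hx) n).continuousAt.const_smul
    (Real.log q ^ n / (n.factorial : ℝ))).continuousWithinAt

theorem QGammaDefinedOn.regular {q r : ℝ} {f : EuclideanSpace ℝ (Fin m) → Cl m}
    (h : QGammaDefinedOn q f (sphere 0 r)) : QGammaRegular q f r := by
  classical
  obtain ⟨ha, hs⟩ := h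
  have hu := hs.hasSumUniformlyOn.tendstoUniformlyOn
  have hcomp := isCompact_sphere (0 : EuclideanSpace ℝ (Fin m)) r
  have hcont : ContinuousOn (qGamma q f) (sphere 0 r) :=
    hu.continuousOn (Filter.Frequently.of_forall fun s =>
      continuousOn_finsetSum s fun n _ => continuousOn_qGammaTerm ha n)
  refine ⟨ha, hcont, ?_⟩
  obtain ⟨G, hG⟩ := hcomp.exists_bound_of_continuousOn hcont
  obtain ⟨s₀, hs₀⟩ := Filter.eventually_atTop.mp
    (Metric.tendstoUniformlyOn_iff.mp hu 1 one_pos)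
  have hc₀ : ContinuousOn (fun x => ∑ n ∈ s₀, ‖qGammaTerm q f n x‖) (sphere 0 r) :=
    continuousOn_finsetSum s₀ fun n _ => (continuousOn_qGammaTerm ha n).norm
  obtain ⟨B₀, hB₀⟩ := hcomp.exists_bound_of_continuousOn hc₀
  refine ⟨_, fun x hx s => sum_norm_le_of_norm_sum_le (C := G + 1 + B₀) s fun t => ?_⟩
  -- a finite sum is the difference of one that extends `s₀`, which is close to the limit, and a
  -- part of the sum over `s₀`
  have h1 : ∑ n ∈ t, qGammaTerm q f n x
      = ∑ n ∈ t ∪ s₀, qGammaTerm q f n x - ∑ n ∈ s₀ \ t, qGammaTerm q f n x := by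
    rw [← Finset.union_sdiff_self_eq_union, Finset.sum_union Finset.disjoint_sdiff,
      add_sub_cancel_right]
  have h2 : ‖∑ n ∈ t ∪ s₀, qGammaTerm q f n x‖ ≤ G + 1 := by
    have h3 := hs₀ (t ∪ s₀) Finset.subset_union_right x hx
    rw [dist_eq_norm, norm_sub_rev] at h3
    have h4 := norm_le_norm_add_norm_sub' (∑ n ∈ t ∪ s₀, qGammaTerm q f n x) (qGamma q f x)
    have h5 := hG x hx
    have h6 : ‖∑ n ∈ t ∪ s₀, qGammaTerm q f n x - qGamma q f x‖ < 1 := h3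
    linarith
  have h3 : ‖∑ n ∈ s₀ \ t, qGammaTerm q f n x‖ ≤ B₀ := by
    refine (norm_sum_le _ _).trans ((Finset.sum_le_sum_of_subset_of_nonneg
      Finset.sdiff_subset fun _ _ _ => norm_nonneg _).trans ?_)
    exact (le_abs_self _).trans (hB₀ x hx)
  rw [h1]
  exact (norm_sub_le _ _).trans (add_le_add h2 h3)

theorem QGammaRegular.summable {q r : ℝ} {f : EuclideanSpace ℝ (Fin m) → Cl m}
    (h : QGammaRegular q f r) {x : EuclideanSpace ℝ (Fin m)} (hx : x ∈ sphere 0 r) :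
    Summable fun n => qGammaTerm q f n x := by
  obtain ⟨B, hB⟩ := h.bounded
  exact (summable_of_sum_le (fun _ => norm_nonneg _) (hB x hx)).of_norm

theorem qGammaTerm_comp_smul (q c : ℝ) (f : EuclideanSpace ℝ (Fin m) → Cl m) (n : ℕ)
    (x : EuclideanSpace ℝ (Fin m)) :
    qGammaTerm q (fun y => f (c • y)) n x = qGammaTerm q f n (c • x) := by
  rw [qGammaTerm, qGammaTerm, Gam_iterate_comp_smul]

theorem qGamma_comp_smul (q c : ℝ) (f : EuclideanSpace ℝ (Fin m) → Cl m)
    (x : EuclideanSpace ℝ (Fin m)) :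
    qGamma q (fun y => f (c • y)) x = qGamma q f (c • x) := by
  simp only [qGamma, qGammaTerm_comp_smul]

theorem QGammaRegular.comp_smul {q c r : ℝ} (hc : 0 ≤ c) {f : EuclideanSpace ℝ (Fin m) → Cl m}
    (h : QGammaRegular q f (c * r)) : QGammaRegular q (fun y => f (c • y)) r := by
  have hmem : ∀ x ∈ sphere (0 : EuclideanSpace ℝ (Fin m)) r,
      c • x ∈ sphere (0 : EuclideanSpace ℝ (Fin m)) (c * r) := by
    intro x hx
    rw [mem_sphere_zero_iff_norm] at hx ⊢
    rw [norm_smul, hx, Real.norm_of_nonneg hc]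
  refine ⟨fun x hx => ?_, ?_, ?_⟩
  · exact (h.analyticOnNhd _ (hmem x hx)).fun_comp (f := fun y => c • y)
      ((c • ContinuousLinearMap.id ℝ (EuclideanSpace ℝ (Fin m))).analyticAt x)
  · simp only [funext (qGamma_comp_smul q c f)]
    exact h.continuousOn.comp (by fun_prop) hmem
  · obtain ⟨B, hB⟩ := h.bounded
    refine ⟨B, fun x hx s => ?_⟩
    simp only [qGammaTerm_comp_smul]
    exact hB _ (hmem x hx) s

/-- A series of continuous functions on the unit sphere whose sums of norms are uniformly bounded
may be integrated termwise. -/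
theorem hasSum_integral_sphere {ι : Type*} [Countable ι]
    {F : ι → sphere (0 : EuclideanSpace ℝ (Fin m)) 1 → Cl m} (hF : ∀ i, Continuous (F i))
    {B : ℝ} (hB : ∀ ξ, ∀ s : Finset ι, ∑ i ∈ s, ‖F i ξ‖ ≤ B) :
    HasSum (fun i => ∫ ξ, F i ξ ∂sphereMeasure m) (∫ ξ, ∑' i, F i ξ ∂sphereMeasure m) := by
  have hint : ∀ i, Integrable (F i) (sphereMeasure m) := fun i =>
    integrable_sphere_of_continuous (hF i)
  refine hasSum_integral_of_summable_integral_norm hint ?_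
  refine summable_of_sum_le (c := ∫ _, B ∂sphereMeasure m)
    (fun i => integral_nonneg fun _ => norm_nonneg _) fun s => ?_
  rw [← integral_finsetSum _ fun i _ => (hint i).norm]
  exact integral_mono (integrable_finsetSum _ fun i _ => (hint i).norm) (integrable_const B)
    fun ξ => hB ξ s

/-- Iterating the selfadjointness of the Gamma operator. -/
theorem integral_star_Gam_iterate_mul {r : ℝ} (hr : 0 ≤ r)
    {u v : EuclideanSpace ℝ (Fin m) → Cl m} (hu : AnalyticOnNhd ℝ u (sphere 0 r))
    (hv : AnalyticOnNhd ℝ v (sphere 0 r)) (n : ℕ) :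
    ∫ ξ, star ((Gam^[n] u) (r • ξ.1)) * v (r • ξ.1) ∂sphereMeasure m
      = ∫ ξ, star (u (r • ξ.1)) * (Gam^[n] v) (r • ξ.1) ∂sphereMeasure m := by
  induction n generalizing v with
  | zero => rfl
  | succ n ih =>
    rw [Function.iterate_succ_apply', Function.iterate_succ_apply,
      integral_star_Gam_mul hr (fun x hx => analyticAt_Gam_iterate (hu x hx) n) hv]
    exact ih fun x hx => analyticAt_Gam (hv x hx)

/-- The operator `q^Γ` is selfadjoint on each sphere. -/
theorem integral_star_qGamma_mul {q r : ℝ} (hr : 0 ≤ r)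
    {u v : EuclideanSpace ℝ (Fin m) → Cl m} (hu : QGammaRegular q u r)
    (hv : QGammaRegular q v r) :
    ∫ ξ, star (qGamma q u (r • ξ.1)) * v (r • ξ.1) ∂sphereMeasure m
      = ∫ ξ, star (u (r • ξ.1)) * qGamma q v (r • ξ.1) ∂sphereMeasure m := by
  obtain ⟨M, hM, hmul⟩ := exists_norm_mul_le m
  obtain ⟨S, hS, hstar⟩ := exists_norm_star_le m
  have hcomp := isCompact_sphere (0 : EuclideanSpace ℝ (Fin m)) r
  obtain ⟨U, hU⟩ := hcomp.exists_bound_of_continuousOn hu.analyticOnNhd.continuousOn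
  obtain ⟨V, hV⟩ := hcomp.exists_bound_of_continuousOn hv.analyticOnNhd.continuousOn
  obtain ⟨Bu, hBu⟩ := hu.bounded
  obtain ⟨Bv, hBv⟩ := hv.bounded
  have hleft : ∀ ξ : sphere (0 : EuclideanSpace ℝ (Fin m)) 1,
      star (qGamma q u (r • ξ.1)) * v (r • ξ.1)
        = ∑' n, star (qGammaTerm q u n (r • ξ.1)) * v (r • ξ.1) := fun ξ =>
    (((mulCLM m).flip (v (r • ξ.1))).comp (starCLM m)).map_tsum
      (hu.summable (smul_mem_sphere hr ξ))
  have hright : ∀ ξ : sphere (0 : EuclideanSpace ℝ (Fin m)) 1,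
      star (u (r • ξ.1)) * qGamma q v (r • ξ.1)
        = ∑' n, star (u (r • ξ.1)) * qGammaTerm q v n (r • ξ.1) := fun ξ =>
    (mulCLM m (star (u (r • ξ.1)))).map_tsum (hv.summable (smul_mem_sphere hr ξ))
  have hcu := continuous_comp_smul_sphere hr hu.analyticOnNhd.continuousOn
  have hcv := continuous_comp_smul_sphere hr hv.analyticOnNhd.continuousOn
  have hsl := hasSum_integral_sphere (m := m)
    (F := fun n ξ => star (qGammaTerm q u n (r • ξ.1)) * v (r • ξ.1))
    (fun n => (continuous_comp_smul_sphere hr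
      (continuousOn_qGammaTerm hu.analyticOnNhd n)).star.mul hcv) (B := M * S * Bu * V)
    (fun ξ s => by
      have hx := smul_mem_sphere hr ξ
      have hV0 : 0 ≤ V := (norm_nonneg _).trans (hV _ hx)
      calc ∑ n ∈ s, ‖star (qGammaTerm q u n (r • ξ.1)) * v (r • ξ.1)‖
          ≤ ∑ n ∈ s, M * S * ‖qGammaTerm q u n (r • ξ.1)‖ * V := by
            refine Finset.sum_le_sum fun n _ => (hmul _ _).trans ?_
            rw [mul_assoc M S]
            exact mul_le_mul (mul_le_mul_of_nonneg_left (hstar _) hM) (hV _ hx)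
              (norm_nonneg _) (by positivity)
        _ = M * S * (∑ n ∈ s, ‖qGammaTerm q u n (r • ξ.1)‖) * V := by
            rw [Finset.mul_sum, Finset.sum_mul]
        _ ≤ M * S * Bu * V := by
            gcongr
            exact hBu _ hx s)
  have hsr := hasSum_integral_sphere (m := m)
    (F := fun n ξ => star (u (r • ξ.1)) * qGammaTerm q v n (r • ξ.1))
    (fun n => hcu.star.mul (continuous_comp_smul_sphere hr
      (continuousOn_qGammaTerm hv.analyticOnNhd n))) (B := M * (S * U) * Bv)
    (fun ξ s => by
      have hx := smul_mem_sphere hr ξ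
      have hU0 : 0 ≤ U := (norm_nonneg _).trans (hU _ hx)
      calc ∑ n ∈ s, ‖star (u (r • ξ.1)) * qGammaTerm q v n (r • ξ.1)‖
          ≤ ∑ n ∈ s, M * (S * U) * ‖qGammaTerm q v n (r • ξ.1)‖ := by
            refine Finset.sum_le_sum fun n _ => (hmul _ _).trans ?_
            gcongr
            exact (hstar _).trans (mul_le_mul_of_nonneg_left (hU _ hx) hS)
        _ = M * (S * U) * ∑ n ∈ s, ‖qGammaTerm q v n (r • ξ.1)‖ := by
            rw [Finset.mul_sum]
        _ ≤ M * (S * U) * Bv := by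
            gcongr
            exact hBv _ hx s)
  simp only [hleft, hright]
  rw [← hsl.tsum_eq, ← hsr.tsum_eq]
  refine tsum_congr fun n => ?_
  simp only [qGammaTerm, CliffordAlgebra.star_smul, smul_mul_assoc, mul_smul_comm]
  rw [integral_smul, integral_smul,
    integral_star_Gam_iterate_mul hr hu.analyticOnNhd hv.analyticOnNhd]

/-- A binomial recursion: if `I (a + 1) b + I a (b + 1) = c I a b`, then the antidiagonal sums
with binomial weights are `c ^ n I 0 0`. -/
theorem sum_antidiagonal_choose_smul {V : Type*} [AddCommGroup V] [Module ℝ V] {I : ℕ → ℕ → V}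
    {c : ℝ} (h : ∀ a b, I a (b + 1) + I (a + 1) b = c • I a b) (n : ℕ) :
    ∑ p ∈ antidiagonal n, n.choose p.1 • I p.1 p.2 = c ^ n • I 0 0 := by
  induction n with
  | zero => simp
  | succ n ih =>
    rw [Finset.sum_antidiagonal_choose_succ_nsmul, pow_succ', mul_smul, ← ih, Finset.smul_sum,
      ← Finset.sum_add_distrib]
    refine Finset.sum_congr rfl fun p hp => ?_
    rw [Nat.choose_symm_of_eq_add (mem_antidiagonal.mp hp).symm, ← nsmul_add, h, smul_comm]

/-- The relation `Γ x = x (m - 1 - Γ)` under the integral, with one `Γ` moved to the left factor. -/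
theorem integral_star_mul_vec_mul_Gam {r : ℝ} (hr : 0 ≤ r)
    {u v : EuclideanSpace ℝ (Fin m) → Cl m}
    (hu : AnalyticOnNhd ℝ u (sphere 0 r)) (hv : AnalyticOnNhd ℝ v (sphere 0 r)) :
    ∫ ξ, star (u (r • ξ.1)) * (vec (r • ξ.1) * Gam v (r • ξ.1)) ∂sphereMeasure m
      + ∫ ξ, star (Gam u (r • ξ.1)) * (vec (r • ξ.1) * v (r • ξ.1)) ∂sphereMeasure m
      = ((m : ℝ) - 1) •
        ∫ ξ, star (u (r • ξ.1)) * (vec (r • ξ.1) * v (r • ξ.1)) ∂sphereMeasure m := by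
  have hcont : ∀ {f : EuclideanSpace ℝ (Fin m) → Cl m}, AnalyticOnNhd ℝ f (sphere 0 r) →
      Continuous fun ξ : sphere (0 : EuclideanSpace ℝ (Fin m)) 1 =>
        star (u (r • ξ.1)) * (vec (r • ξ.1) * f (r • ξ.1)) := fun hf =>
    (continuous_comp_smul_sphere hr hu.continuousOn).star.mul
      ((continuous_vec.comp (by fun_prop)).mul (continuous_comp_smul_sphere hr hf.continuousOn))
  have hGv : AnalyticOnNhd ℝ (Gam v) (sphere 0 r) := fun x hx => analyticAt_Gam (hv x hx)
  rw [integral_star_Gam_mul (v := fun x => vec x * v x) hr hu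
    fun x hx => analyticAt_mul (analyticAt_vec x) (hv x hx), ← integral_smul,
    ← integral_add (integrable_sphere_of_continuous (hcont hGv))
      (integrable_sphere_of_continuous ?_)]
  · refine integral_congr_ae (Filter.Eventually.of_forall fun ξ => ?_)
    have hx := smul_mem_sphere hr ξ
    simp only [Gam_vec_mul (hv _ hx).differentiableAt]
    rw [mul_sub, mul_sub, mul_smul_comm, mul_smul_comm]
    abel
  · have hxv : AnalyticOnNhd ℝ (fun x => vec x * v x) (sphere 0 r) := fun x hx =>
      analyticAt_mul (analyticAt_vec x) (hv x hx)
    exact (continuous_comp_smul_sphere hr hu.continuousOn).star.mul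
      (continuous_comp_smul_sphere hr (f := Gam fun x => vec x * v x)
        fun x hx => (analyticAt_Gam (hxv x hx)).continuousAt.continuousWithinAt)

/-- Since `Γ x = x (m - 1 - Γ)` and `Γ` is selfadjoint, applying `q^Γ` to both arguments of the
pairing `∫ \bar u x v` multiplies it by `q^{m-1}`. -/
theorem integral_star_qGamma_mul_vec_mul_qGamma {q r : ℝ} (hq : 0 < q) (hm : 1 ≤ m) (hr : 0 ≤ r)
    {u v : EuclideanSpace ℝ (Fin m) → Cl m} (hu : QGammaRegular q u r)
    (hv : QGammaRegular q v r) :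
    ∫ ξ, star (qGamma q u (r • ξ.1)) * (vec (r • ξ.1) * qGamma q v (r • ξ.1)) ∂sphereMeasure m
      = q ^ (m - 1) •
        ∫ ξ, star (u (r • ξ.1)) * (vec (r • ξ.1) * v (r • ξ.1)) ∂sphereMeasure m := by
  classical
  obtain ⟨M, hM, hmul⟩ := exists_norm_mul_le m
  obtain ⟨S, hS, hstar⟩ := exists_norm_star_le m
  have hcomp := isCompact_sphere (0 : EuclideanSpace ℝ (Fin m)) r
  obtain ⟨X, hX⟩ := hcomp.exists_bound_of_continuousOn
    (continuous_vec (m := m)).continuousOn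
  obtain ⟨Bu, hBu⟩ := hu.bounded
  obtain ⟨Bv, hBv⟩ := hv.bounded
  let F : ℕ × ℕ → sphere (0 : EuclideanSpace ℝ (Fin m)) 1 → Cl m := fun p ξ =>
    star (qGammaTerm q u p.1 (r • ξ.1)) * (vec (r • ξ.1) * qGammaTerm q v p.2 (r • ξ.1))
  have hbound : ∀ ξ, ∀ s : Finset (ℕ × ℕ), ∑ p ∈ s, ‖F p ξ‖ ≤ M * (S * Bu) * (M * X * Bv) := by
    intro ξ s
    have hx := smul_mem_sphere hr ξ
    have hX0 : 0 ≤ X := (norm_nonneg _).trans (hX _ hx)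
    have hBu0 : 0 ≤ Bu := by simpa using hBu _ hx ∅
    calc ∑ p ∈ s, ‖F p ξ‖
        ≤ ∑ p ∈ s.image Prod.fst ×ˢ s.image Prod.snd, ‖F p ξ‖ :=
          Finset.sum_le_sum_of_subset_of_nonneg Finset.subset_product
            fun _ _ _ => norm_nonneg _
      _ ≤ ∑ p ∈ s.image Prod.fst ×ˢ s.image Prod.snd,
            (M * (S * ‖qGammaTerm q u p.1 (r • ξ.1)‖)) *
              (M * X * ‖qGammaTerm q v p.2 (r • ξ.1)‖) := by
          refine Finset.sum_le_sum fun p _ => (hmul _ _).trans ?_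
          have h1 := (hmul (vec (r • ξ.1)) (qGammaTerm q v p.2 (r • ξ.1))).trans
            (mul_le_mul_of_nonneg_right (mul_le_mul_of_nonneg_left (hX _ hx) hM)
              (norm_nonneg _))
          gcongr
          exact hstar _
      _ = (M * (S * ∑ n ∈ s.image Prod.fst, ‖qGammaTerm q u n (r • ξ.1)‖)) *
            (M * X * ∑ n ∈ s.image Prod.snd, ‖qGammaTerm q v n (r • ξ.1)‖) := by
          rw [Finset.sum_product]
          simp only [Finset.mul_sum, Finset.sum_mul]
          exact Finset.sum_comm
      _ ≤ M * (S * Bu) * (M * X * Bv) := by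
          gcongr
          · exact hBu _ hx _
          · exact hBv _ hx _
  have hFc : ∀ p, Continuous (F p) := fun p =>
    (continuous_comp_smul_sphere hr (continuousOn_qGammaTerm hu.analyticOnNhd p.1)).star.mul
      ((continuous_vec.comp (by fun_prop)).mul
        (continuous_comp_smul_sphere hr (continuousOn_qGammaTerm hv.analyticOnNhd p.2)))
  have hpt : ∀ ξ : sphere (0 : EuclideanSpace ℝ (Fin m)) 1,
      star (qGamma q u (r • ξ.1)) * (vec (r • ξ.1) * qGamma q v (r • ξ.1)) = ∑' p, F p ξ := by
    intro ξ
    have hx := smul_mem_sphere hr ξ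
    have hsum : Summable fun p => F p ξ :=
      (summable_of_sum_le (fun _ => norm_nonneg _) (hbound ξ)).of_norm
    rw [hsum.tsum_prod]
    have h1 : ∀ a, ∑' b, F (a, b) ξ
        = star (qGammaTerm q u a (r • ξ.1)) * (vec (r • ξ.1) * qGamma q v (r • ξ.1)) := fun a =>
      (((mulCLM m (star (qGammaTerm q u a (r • ξ.1)))).comp
        (mulCLM m (vec (r • ξ.1)))).map_tsum (hv.summable hx)).symm
    simp only [h1]
    exact (((mulCLM m).flip (vec (r • ξ.1) * qGamma q v (r • ξ.1))).comp (starCLM m)).map_tsum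
      (hu.summable hx)
  have hF := hasSum_integral_sphere hFc hbound
  let I : ℕ → ℕ → Cl m := fun a b =>
    ∫ ξ, star ((Gam^[a] u) (r • ξ.1)) * (vec (r • ξ.1) * (Gam^[b] v) (r • ξ.1)) ∂sphereMeasure m
  have hI : ∀ a b, I a (b + 1) + I (a + 1) b = ((m : ℝ) - 1) • I a b := by
    intro a b
    simp only [I, Function.iterate_succ_apply']
    exact integral_star_mul_vec_mul_Gam hr (fun x hx => analyticAt_Gam_iterate
      (hu.analyticOnNhd x hx) a) (fun x hx => analyticAt_Gam_iterate (hv.analyticOnNhd x hx) b)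
  have hFI : ∀ p : ℕ × ℕ, ∫ ξ, F p ξ ∂sphereMeasure m
      = (Real.log q ^ p.1 / (p.1.factorial : ℝ) * (Real.log q ^ p.2 / (p.2.factorial : ℝ))) •
        I p.1 p.2 := by
    intro p
    simp only [F, I, qGammaTerm, CliffordAlgebra.star_smul, smul_mul_assoc, mul_smul_comm]
    rw [integral_smul, integral_smul, smul_smul, mul_comm]
  have hanti : ∀ n, ∑ p ∈ antidiagonal n, ∫ ξ, F p ξ ∂sphereMeasure m
      = ((Real.log q * ((m : ℝ) - 1)) ^ n / (n.factorial : ℝ)) • I 0 0 := by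
    intro n
    rw [mul_pow, mul_div_right_comm, mul_smul, ← sum_antidiagonal_choose_smul hI n,
      Finset.smul_sum]
    refine Finset.sum_congr rfl fun p hp => ?_
    rw [hFI, ← Nat.cast_smul_eq_nsmul ℝ, smul_smul]
    congr 1
    have hp' := mem_antidiagonal.mp hp
    rw [← hp', Nat.choose_symm_add, Nat.add_choose, Nat.cast_div (Nat.factorial_mul_factorial_dvd_factorial_add _ _)
      (by positivity), pow_add]
    have h1 : ((p.1.factorial : ℕ) : ℝ) ≠ 0 := by positivity
    have h2 : ((p.2.factorial : ℕ) : ℝ) ≠ 0 := by positivity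
    have h3 : (((p.1 + p.2).factorial : ℕ) : ℝ) ≠ 0 := by positivity
    push_cast
    field_simp
  simp only [hpt]
  have hsig := (Finset.HasAntidiagonal.sigmaAntidiagonalEquivProd (A := ℕ)).hasSum_iff.mpr hF
  have hn : HasSum (fun n => ((Real.log q * ((m : ℝ) - 1)) ^ n / (n.factorial : ℝ)) • I 0 0)
      (∫ ξ, ∑' p, F p ξ ∂sphereMeasure m) := by
    simp only [← hanti]
    exact hsig.sigma fun n => Finset.hasSum (antidiagonal n) fun p => ∫ ξ, F p ξ ∂sphereMeasure m
  have hexp : HasSum (fun n => ((Real.log q * ((m : ℝ) - 1)) ^ n / (n.factorial : ℝ)) • I 0 0)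
      (Real.exp (Real.log q * ((m : ℝ) - 1)) • I 0 0) := by
    rw [Real.exp_eq_exp_ℝ]
    exact (NormedSpace.expSeries_div_hasSum_exp (Real.log q * ((m : ℝ) - 1))).smul_const _
  have hpow : Real.exp (Real.log q * ((m : ℝ) - 1)) = q ^ (m - 1) := by
    rw [mul_comm, ← Nat.cast_pred hm, Real.exp_nat_mul, Real.exp_log hq]
  rw [hn.unique hexp, hpow]
  rfl

/-! ### The operator `q^Γ` on power series at the origin -/

/-- The Gamma operator on multilinear maps: the rotation fields act on one argument at a time. On
the diagonal this is the Gamma operator applied to the homogeneous polynomial of the map. -/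
def gamMultilinear {k : ℕ} (p : EuclideanSpace ℝ (Fin m) [×k]→L[ℝ] Cl m) :
    EuclideanSpace ℝ (Fin m) [×k]→L[ℝ] Cl m :=
  ∑ i, ∑ j, ∑ s : Fin k, (mulCLM m (gamCoef i j)).compContinuousMultilinearMap
    (p.compContinuousLinearMap (Function.update
      (fun _ => ContinuousLinearMap.id ℝ (EuclideanSpace ℝ (Fin m))) s (rot i j)))

/-- A bound for the operator norm of the Gamma operator per degree. -/
def gamBound (m : ℕ) : ℝ :=
  ∑ i : Fin m, ∑ j : Fin m, ‖mulCLM m (gamCoef i j)‖ * ‖rot i j‖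

theorem gamBound_nonneg (m : ℕ) : 0 ≤ gamBound m :=
  Finset.sum_nonneg fun i _ => Finset.sum_nonneg fun j _ =>
    mul_nonneg (norm_nonneg (mulCLM m (gamCoef i j))) (norm_nonneg _)

theorem norm_gamMultilinear_le {k : ℕ} (p : EuclideanSpace ℝ (Fin m) [×k]→L[ℝ] Cl m) :
    ‖gamMultilinear p‖ ≤ gamBound m * k * ‖p‖ := by
  have hterm : ∀ (i j : Fin m) (s : Fin k),
      ‖(mulCLM m (gamCoef i j)).compContinuousMultilinearMap
        (p.compContinuousLinearMap (Function.update
          (fun _ => ContinuousLinearMap.id ℝ (EuclideanSpace ℝ (Fin m))) s (rot i j)))‖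
        ≤ ‖mulCLM m (gamCoef i j)‖ * ‖rot i j‖ * ‖p‖ := by
    intro i j s
    refine (ContinuousLinearMap.norm_compContinuousMultilinearMap_le _ _).trans ?_
    rw [mul_assoc]
    refine mul_le_mul_of_nonneg_left ?_ (norm_nonneg (mulCLM m (gamCoef i j)))
    refine (ContinuousMultilinearMap.norm_compContinuousLinearMap_le _ _).trans ?_
    rw [mul_comm]
    refine mul_le_mul_of_nonneg_right ?_ (norm_nonneg p)
    rw [← Finset.mul_prod_erase _ _ (Finset.mem_univ s), Function.update_self]
    refine mul_le_of_le_one_right (norm_nonneg _)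
      (Finset.prod_le_one (fun _ _ => norm_nonneg _) fun t ht => ?_)
    rw [Function.update_of_ne (Finset.ne_of_mem_erase ht)]
    exact ContinuousLinearMap.norm_id_le
  unfold gamMultilinear gamBound
  rw [Finset.sum_mul, Finset.sum_mul]
  refine (norm_sum_le _ _).trans (Finset.sum_le_sum fun i _ => ?_)
  rw [Finset.sum_mul, Finset.sum_mul]
  refine (norm_sum_le _ _).trans (Finset.sum_le_sum fun j _ => ?_)
  refine (norm_sum_le _ _).trans ((Finset.sum_le_sum fun s _ => hterm i j s).trans ?_)
  rw [Finset.sum_const, Finset.card_univ, Fintype.card_fin, nsmul_eq_mul]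
  exact le_of_eq (by ring)

theorem gamMultilinear_diag {k : ℕ} (p : EuclideanSpace ℝ (Fin m) [×k]→L[ℝ] Cl m)
    (y : EuclideanSpace ℝ (Fin m)) :
    gamMultilinear p (fun _ => y)
      = ∑ i, ∑ j, gamCoef i j * ∑ s, p (Function.update (fun _ => y) s (rot i j y)) := by
  simp only [gamMultilinear, _root_.sum_apply,
    ContinuousLinearMap.compContinuousMultilinearMap_coe, Function.comp_apply,
    ContinuousMultilinearMap.compContinuousLinearMap_apply, mulCLM_apply, Finset.mul_sum]
  refine Finset.sum_congr rfl fun i _ => Finset.sum_congr rfl fun j _ =>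
    Finset.sum_congr rfl fun s _ => ?_
  congr 2
  funext t
  by_cases h : t = s
  · subst h; simp
  · simp [h]

/-- The derivative of the homogeneous polynomial of a multilinear map. -/
theorem hasFDerivAt_diag {k : ℕ} (p : EuclideanSpace ℝ (Fin m) [×k]→L[ℝ] Cl m)
    (y : EuclideanSpace ℝ (Fin m)) :
    HasFDerivAt (fun z : EuclideanSpace ℝ (Fin m) => p fun _ => z)
      ((p.linearDeriv fun _ => y).comp
        (ContinuousLinearMap.pi fun _ => ContinuousLinearMap.id ℝ _)) y :=
  (p.hasFDerivAt fun _ => y).comp y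
    (ContinuousLinearMap.pi fun _ : Fin k =>
      ContinuousLinearMap.id ℝ (EuclideanSpace ℝ (Fin m))).hasFDerivAt

theorem norm_linearDeriv_diag_le {k : ℕ} (p : EuclideanSpace ℝ (Fin m) [×k]→L[ℝ] Cl m)
    (y : EuclideanSpace ℝ (Fin m)) :
    ‖(p.linearDeriv fun _ => y).comp
        (ContinuousLinearMap.pi fun _ => ContinuousLinearMap.id ℝ _)‖
      ≤ k * ‖p‖ * ‖y‖ ^ (k - 1) := by
  refine ContinuousLinearMap.opNorm_le_bound _ (by positivity) fun v => ?_
  simp only [ContinuousLinearMap.comp_apply, ContinuousMultilinearMap.linearDeriv_apply]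
  refine (norm_sum_le _ _).trans ?_
  have h : ∀ s : Fin k, ‖p (Function.update (fun _ => y) s v)‖ ≤ ‖p‖ * (‖v‖ * ‖y‖ ^ (k - 1)) := by
    intro s
    refine (p.le_opNorm _).trans (le_of_eq ?_)
    rw [← Finset.mul_prod_erase _ _ (Finset.mem_univ s), Function.update_self,
      Finset.prod_congr rfl fun t ht => by rw [Function.update_of_ne (Finset.ne_of_mem_erase ht)],
      Finset.prod_const, Finset.card_erase_of_mem (Finset.mem_univ s), Finset.card_univ,
      Fintype.card_fin]
  refine (Finset.sum_le_sum fun s _ => h s).trans (le_of_eq ?_)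
  rw [Finset.sum_const, Finset.card_univ, Fintype.card_fin, nsmul_eq_mul]
  ring

/-- The Gamma operator may be applied termwise to an expansion in homogeneous polynomials. -/
theorem hasSum_Gam {f : EuclideanSpace ℝ (Fin m) → Cl m}
    {p : FormalMultilinearSeries ℝ (EuclideanSpace ℝ (Fin m)) (Cl m)} {C a δ : ℝ} {n : ℕ}
    (ha : 0 < a) (haδ : a * δ ≤ 1) (hp : ∀ k : ℕ, ‖p k‖ ≤ C * (k : ℝ) ^ n * a ^ k)
    (hf : ∀ y ∈ ball (0 : EuclideanSpace ℝ (Fin m)) δ, HasSum (fun k => p k fun _ => y) (f y)) :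
    ∀ y ∈ ball (0 : EuclideanSpace ℝ (Fin m)) δ,
      HasSum (fun k => gamMultilinear (p k) fun _ => y) (Gam f y) := by
  intro y hy
  have hyδ : ‖y‖ < δ := by simpa using hy
  obtain ⟨d, hyd, hdδ⟩ := exists_between hyδ
  have hd0 : 0 < d := (norm_nonneg y).trans_lt hyd
  have had : ‖a * d‖ < 1 := by
    rw [Real.norm_of_nonneg (by positivity)]
    exact (mul_lt_mul_of_pos_left hdδ ha).trans_le haδ
  have hC : 0 ≤ C := by
    by_contra! hneg
    have h1 := (norm_nonneg _).trans (hp 1)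
    simp only [Nat.cast_one, one_pow, mul_one, pow_one] at h1
    exact absurd h1 (not_le.mpr (mul_neg_of_neg_of_pos hneg ha))
  let f' : ℕ → EuclideanSpace ℝ (Fin m) → EuclideanSpace ℝ (Fin m) →L[ℝ] Cl m := fun k z =>
    ((p k).linearDeriv fun _ => z).comp
      (ContinuousLinearMap.pi fun _ => ContinuousLinearMap.id ℝ _)
  have hu : Summable fun k : ℕ => C / d * ((k : ℝ) ^ (n + 1) * (a * d) ^ k) :=
    (summable_pow_mul_geometric_of_norm_lt_one (n + 1) had).mul_left _
  have hbound : ∀ k, ∀ z ∈ ball (0 : EuclideanSpace ℝ (Fin m)) d,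
      ‖f' k z‖ ≤ C / d * ((k : ℝ) ^ (n + 1) * (a * d) ^ k) := by
    intro k z hz
    have hz' : ‖z‖ ≤ d := by simpa using (mem_ball_zero_iff.mp hz).le
    refine (norm_linearDeriv_diag_le (p k) z).trans ?_
    rcases k with _ | k
    · simp
    calc ((k + 1 : ℕ) : ℝ) * ‖p (k + 1)‖ * ‖z‖ ^ (k + 1 - 1)
        ≤ ((k + 1 : ℕ) : ℝ) * (C * ((k + 1 : ℕ) : ℝ) ^ n * a ^ (k + 1)) * d ^ k := by
          gcongr
          · exact hp (k + 1)
          · simpa using pow_le_pow_left₀ (norm_nonneg z) hz' k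
      _ = C / d * (((k + 1 : ℕ) : ℝ) ^ (n + 1) * (a * d) ^ (k + 1)) := by
          field_simp
          ring
  have hyb : y ∈ ball (0 : EuclideanSpace ℝ (Fin m)) d := by simpa using hyd
  have hder : HasFDerivAt (fun z => ∑' k, p k fun _ => z) (∑' k, f' k y) y :=
    hasFDerivAt_tsum_of_isPreconnected hu isOpen_ball (convex_ball _ _).isPreconnected
      (fun k z _ => hasFDerivAt_diag (p k) z) hbound hyb
      (hf y hy).summable hyb
  have hloc : f =ᶠ[𝓝 y] fun z => ∑' k, p k fun _ => z := by
    filter_upwards [isOpen_ball.mem_nhds hy] with z hz using (hf z hz).tsum_eq.symm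
  have hfd : fderiv ℝ f y = ∑' k, f' k y := by rw [hloc.fderiv_eq, hder.fderiv]
  have hsum : HasSum (fun k => f' k y) (fderiv ℝ f y) := by
    rw [hfd]
    exact (Summable.of_norm_bounded hu fun k => hbound k y hyb).hasSum
  rw [Gam_eq_sum_rot]
  simp only [gamMultilinear_diag]
  refine hasSum_sum fun i _ => hasSum_sum fun j _ => ?_
  have h := ((mulCLM m (gamCoef i j)).comp
    (ContinuousLinearMap.apply ℝ (Cl m) (rot i j y))).hasSum hsum
  simpa [f', ContinuousMultilinearMap.linearDeriv_apply, Function.comp_def, Finset.mul_sum] using h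

theorem norm_gamMultilinear_iterate_le {k : ℕ} (p : EuclideanSpace ℝ (Fin m) [×k]→L[ℝ] Cl m)
    (n : ℕ) : ‖gamMultilinear^[n] p‖ ≤ (gamBound m * k) ^ n * ‖p‖ := by
  induction n with
  | zero => simp
  | succ n ih =>
    rw [Function.iterate_succ_apply', pow_succ', mul_assoc]
    exact (norm_gamMultilinear_le _).trans (mul_le_mul_of_nonneg_left ih
      (mul_nonneg (gamBound_nonneg m) (Nat.cast_nonneg k)))

theorem hasSum_Gam_iterate {f : EuclideanSpace ℝ (Fin m) → Cl m}
    {p : FormalMultilinearSeries ℝ (EuclideanSpace ℝ (Fin m)) (Cl m)} {C a δ : ℝ}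
    (ha : 0 < a) (haδ : a * δ ≤ 1) (hp : ∀ k : ℕ, ‖p k‖ ≤ C * a ^ k)
    (hf : ∀ y ∈ ball (0 : EuclideanSpace ℝ (Fin m)) δ, HasSum (fun k => p k fun _ => y) (f y))
    (n : ℕ) :
    ∀ y ∈ ball (0 : EuclideanSpace ℝ (Fin m)) δ,
      HasSum (fun k => (gamMultilinear^[n] (p k)) fun _ => y) ((Gam^[n] f) y) := by
  induction n with
  | zero => exact hf
  | succ n ih =>
    simp only [Function.iterate_succ_apply']
    refine hasSum_Gam (p := fun k => gamMultilinear^[n] (p k)) (C := gamBound m ^ n * C)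
      (n := n) ha haδ (fun k => ?_) ih
    refine (norm_gamMultilinear_iterate_le _ n).trans ?_
    calc (gamBound m * k) ^ n * ‖p k‖ ≤ (gamBound m * k) ^ n * (C * a ^ k) :=
          mul_le_mul_of_nonneg_left (hp k)
            (pow_nonneg (mul_nonneg (gamBound_nonneg m) (Nat.cast_nonneg k)) n)
      _ = gamBound m ^ n * C * (k : ℝ) ^ n * a ^ k := by rw [mul_pow]; ring

/-- The `n`-th term `(ln q)ⁿ / n! Γⁿ` of the exponential series, on multilinear maps. -/
def qGammaCoeff (q : ℝ) {k : ℕ} (p : EuclideanSpace ℝ (Fin m) [×k]→L[ℝ] Cl m) (n : ℕ) :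
    EuclideanSpace ℝ (Fin m) [×k]→L[ℝ] Cl m :=
  (Real.log q ^ n / (n.factorial : ℝ)) • gamMultilinear^[n] p

/-- The power series of `q^Γ f`: the exponential series of the Gamma operator, degree by degree. -/
def qGammaSeries (q : ℝ) (p : FormalMultilinearSeries ℝ (EuclideanSpace ℝ (Fin m)) (Cl m)) :
    FormalMultilinearSeries ℝ (EuclideanSpace ℝ (Fin m)) (Cl m) := fun k =>
  ∑' n : ℕ, qGammaCoeff q (p k) n

theorem norm_qGammaSeries_term_le (q : ℝ) {k : ℕ}
    (p : EuclideanSpace ℝ (Fin m) [×k]→L[ℝ] Cl m) (n : ℕ) :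
    ‖qGammaCoeff q p n‖
      ≤ (|Real.log q| * gamBound m * k) ^ n / (n.factorial : ℝ) * ‖p‖ := by
  rw [qGammaCoeff, norm_smul, norm_div, norm_pow, Real.norm_eq_abs, RCLike.norm_natCast]
  calc |Real.log q| ^ n / (n.factorial : ℝ) * ‖gamMultilinear^[n] p‖
      ≤ |Real.log q| ^ n / (n.factorial : ℝ) * ((gamBound m * k) ^ n * ‖p‖) := by
        gcongr
        exact norm_gamMultilinear_iterate_le p n
    _ = (|Real.log q| * gamBound m * k) ^ n / (n.factorial : ℝ) * ‖p‖ := by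
        rw [mul_assoc |Real.log q|, mul_pow |Real.log q|]
        ring

theorem hasSum_exp_bound (c b : ℝ) (k : ℕ) :
    HasSum (fun n : ℕ => (c * k) ^ n / (n.factorial : ℝ) * b) (Real.exp c ^ k * b) := by
  rw [← Real.exp_nat_mul, mul_comm (k : ℝ), Real.exp_eq_exp_ℝ]
  exact (NormedSpace.expSeries_div_hasSum_exp (c * k)).mul_right b

theorem norm_qGammaSeries_le (q : ℝ)
    (p : FormalMultilinearSeries ℝ (EuclideanSpace ℝ (Fin m)) (Cl m)) (k : ℕ) :
    ‖qGammaSeries q p k‖ ≤ Real.exp (|Real.log q| * gamBound m) ^ k * ‖p k‖ :=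
  tsum_of_norm_bounded (hasSum_exp_bound (|Real.log q| * gamBound m) ‖p k‖ k) (norm_qGammaSeries_term_le q (p k))

theorem hasSum_qGammaSeries (q : ℝ)
    (p : FormalMultilinearSeries ℝ (EuclideanSpace ℝ (Fin m)) (Cl m)) (k : ℕ) :
    HasSum (fun n : ℕ => qGammaCoeff q (p k) n)
      (qGammaSeries q p k) :=
  (Summable.of_norm_bounded (hasSum_exp_bound (|Real.log q| * gamBound m) ‖p k‖ k).summable
    (norm_qGammaSeries_term_le q (p k))).hasSum

theorem hasSum_qGammaSeries_apply (q : ℝ)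
    (p : FormalMultilinearSeries ℝ (EuclideanSpace ℝ (Fin m)) (Cl m)) (k : ℕ)
    (y : EuclideanSpace ℝ (Fin m)) :
    HasSum (fun n : ℕ => qGammaCoeff q (p k) n fun _ => y) (qGammaSeries q p k fun _ => y) := by
  have h := (ContinuousMultilinearMap.apply ℝ (fun _ : Fin k => EuclideanSpace ℝ (Fin m)) (Cl m)
    fun _ => y).hasSum (hasSum_qGammaSeries q p k)
  exact h

theorem norm_qGammaSeries_term_apply_le (q : ℝ) {k : ℕ}
    (p : EuclideanSpace ℝ (Fin m) [×k]→L[ℝ] Cl m) (n : ℕ) (y : EuclideanSpace ℝ (Fin m)) :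
    ‖qGammaCoeff q p n fun _ => y‖
      ≤ (|Real.log q| * gamBound m * k) ^ n / (n.factorial : ℝ) * (‖p‖ * ‖y‖ ^ k) := by
  have h := (qGammaCoeff q p n).le_opNorm fun _ => y
  rw [Finset.prod_const, Finset.card_univ, Fintype.card_fin] at h
  rw [← mul_assoc]
  exact h.trans (mul_le_mul_of_nonneg_right (norm_qGammaSeries_term_le q p n) (by positivity))

/-- The double series that dominates the exponential series of the Gamma operator applied to a
power series. -/
theorem summable_exp_geometric {c a C t : ℝ} (hc : 0 ≤ c) (ha : 0 ≤ a) (hC : 0 ≤ C) (ht : 0 ≤ t)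
    (h : Real.exp c * a * t ≤ 1 / 2) {P : ℕ → ℝ} (hP0 : ∀ k, 0 ≤ P k)
    (hP : ∀ k, P k ≤ C * a ^ k) :
    Summable fun z : ℕ × ℕ => (c * z.1) ^ z.2 / (z.2.factorial : ℝ) * (P z.1 * t ^ z.1) := by
  rw [summable_prod_of_nonneg fun z => mul_nonneg (by positivity)
    (mul_nonneg (hP0 z.1) (pow_nonneg ht z.1))]
  have hs : ∀ k : ℕ, HasSum (fun n : ℕ => (c * k) ^ n / (n.factorial : ℝ) * (P k * t ^ k))
      (Real.exp c ^ k * (P k * t ^ k)) := fun k => hasSum_exp_bound c (P k * t ^ k) k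
  dsimp only
  refine ⟨fun k => (hs k).summable, ?_⟩
  rw [show (fun k : ℕ => ∑' n : ℕ, (c * k) ^ n / (n.factorial : ℝ) * (P k * t ^ k))
    = fun k => Real.exp c ^ k * (P k * t ^ k) from funext fun k => (hs k).tsum_eq]
  refine Summable.of_nonneg_of_le
    (fun k => mul_nonneg (by positivity) (mul_nonneg (hP0 k) (pow_nonneg ht k))) (fun k => ?_)
    ((summable_geometric_of_lt_one (r := (1 / 2 : ℝ)) (by norm_num) (by norm_num)).mul_left C)
  calc Real.exp c ^ k * (P k * t ^ k) ≤ Real.exp c ^ k * (C * a ^ k * t ^ k) := by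
        gcongr
        exact hP k
    _ = C * (Real.exp c * a * t) ^ k := by
        rw [mul_pow, mul_pow]; ring
    _ ≤ C * (1 / 2) ^ k := by gcongr

theorem summable_qGammaCoeff (q : ℝ)
    {p : FormalMultilinearSeries ℝ (EuclideanSpace ℝ (Fin m)) (Cl m)} {C a : ℝ}
    (ha : 0 < a) (hC : 0 ≤ C) (hp : ∀ k : ℕ, ‖p k‖ ≤ C * a ^ k) {y : EuclideanSpace ℝ (Fin m)}
    (hb : Real.exp (|Real.log q| * gamBound m) * a * ‖y‖ ≤ 1 / 2) :
    Summable fun z : ℕ × ℕ => qGammaCoeff q (p z.1) z.2 fun _ => y :=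
  Summable.of_norm_bounded
    (summable_exp_geometric (mul_nonneg (abs_nonneg _) (gamBound_nonneg m)) ha.le hC
      (norm_nonneg y) hb (P := fun k => ‖p k‖) (fun k => norm_nonneg (p k)) hp)
    (fun z => norm_qGammaSeries_term_apply_le q (p z.1) z.2 y)

/-- The double series over the power `n` of `Γ` and the degree `k` may be summed in either order:
over `k` first it gives the terms of `q^Γ f`, over `n` first its power series. -/
theorem hasSum_qGamma (q : ℝ) {f : EuclideanSpace ℝ (Fin m) → Cl m}
    {p : FormalMultilinearSeries ℝ (EuclideanSpace ℝ (Fin m)) (Cl m)} {C a δ : ℝ}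
    (ha : 0 < a) (haδ : a * δ ≤ 1) (hC : 0 ≤ C) (hp : ∀ k : ℕ, ‖p k‖ ≤ C * a ^ k)
    (hf : ∀ y ∈ ball (0 : EuclideanSpace ℝ (Fin m)) δ, HasSum (fun k => p k fun _ => y) (f y))
    {y : EuclideanSpace ℝ (Fin m)} (hy : y ∈ ball 0 δ)
    (hb : Real.exp (|Real.log q| * gamBound m) * a * ‖y‖ ≤ 1 / 2) :
    HasSum (fun k => qGammaSeries q p k fun _ => y) (qGamma q f y) := by
  have hFs := (summable_qGammaCoeff q ha hC hp hb).hasSum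
  have hcol : ∀ k, HasSum (fun n => qGammaCoeff q (p k) n fun _ => y)
      (qGammaSeries q p k fun _ => y) := fun k => hasSum_qGammaSeries_apply q p k y
  have hrow : ∀ n, HasSum (fun k => qGammaCoeff q (p k) n fun _ => y) (qGammaTerm q f n y) :=
    fun n => (hasSum_Gam_iterate ha haδ hp hf n y hy).const_smul
      (Real.log q ^ n / (n.factorial : ℝ))
  have h1 := hFs.prod_fiberwise hcol
  have h2 := ((Equiv.prodComm ℕ ℕ).hasSum_iff.mpr hFs).prod_fiberwise hrow
  rw [qGamma, h2.tsum_eq]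
  exact h1

theorem qGammaSeries_eq_zero (q : ℝ)
    {p : FormalMultilinearSeries ℝ (EuclideanSpace ℝ (Fin m)) (Cl m)} {k : ℕ} (h : p k = 0) :
    qGammaSeries q p k = 0 := by
  have := norm_qGammaSeries_le q p k
  rw [h, norm_zero, mul_zero] at this
  exact norm_le_zero_iff.mp this

/-- Near the origin the series of `q^Γ f` always converges, to an analytic function: on the
homogeneous part of degree `k` the operator `q^Γ` has norm at most `b ^ k` for some constant `b`,
so that it only shrinks the radius of convergence. -/
theorem hasFPowerSeriesAt_qGamma (q : ℝ) {f : EuclideanSpace ℝ (Fin m) → Cl m}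
    {p : FormalMultilinearSeries ℝ (EuclideanSpace ℝ (Fin m)) (Cl m)}
    (hf : HasFPowerSeriesAt f p 0) : HasFPowerSeriesAt (qGamma q f) (qGammaSeries q p) 0 := by
  obtain ⟨ρ, hρ⟩ := hf
  obtain ⟨C, a, hC, ha, hp⟩ := p.le_mul_pow_of_radius_pos (hρ.r_pos.trans_le hρ.r_le)
  obtain ⟨ρ', hρ'0, hρ'⟩ := ENNReal.lt_iff_exists_nnreal_btwn.mp hρ.r_pos
  have hρ'pos : 0 < (ρ' : ℝ) := by exact_mod_cast hρ'0
  set b := Real.exp (|Real.log q| * gamBound m) with hb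
  have hb1 : 1 ≤ b := Real.one_le_exp (mul_nonneg (abs_nonneg _) (gamBound_nonneg m))
  -- the radius `δ` makes the terms of degree `k` decay like `2⁻ᵏ` even after `q^Γ`
  obtain ⟨δ, hδ0, hδρ, hδa⟩ : ∃ δ : NNReal, 0 < δ ∧ δ ≤ ρ' ∧ b * a * δ ≤ 1 / 2 := by
    refine ⟨min ρ' (Real.toNNReal (1 / (2 * (b * a)))), ?_, min_le_left _ _, ?_⟩
    · exact lt_min (by exact_mod_cast hρ'pos) (Real.toNNReal_pos.mpr (by positivity))
    · have h1 : ((min ρ' (Real.toNNReal (1 / (2 * (b * a)))) : NNReal) : ℝ)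
          ≤ 1 / (2 * (b * a)) := by
        refine (NNReal.coe_le_coe.mpr (min_le_right _ _)).trans (le_of_eq ?_)
        exact Real.coe_toNNReal _ (by positivity)
      calc b * a * _ ≤ b * a * (1 / (2 * (b * a))) := by gcongr
        _ = 1 / 2 := by field_simp
  have haδ : a * δ ≤ 1 := by
    have : a * δ ≤ b * a * δ := by
      rw [mul_assoc]
      exact le_mul_of_one_le_left (by positivity) hb1
    linarith
  have hfs : ∀ y ∈ ball (0 : EuclideanSpace ℝ (Fin m)) δ,
      HasSum (fun k => p k fun _ => y) (f y) := by
    intro y hy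
    have hy' : y ∈ Metric.eball (0 : EuclideanSpace ℝ (Fin m)) ρ := by
      rw [mem_eball, edist_zero_right]
      have h1 : ‖y‖ < ρ' := (mem_ball_zero_iff.mp hy).trans_le (by exact_mod_cast hδρ)
      refine lt_trans ?_ hρ'
      rw [← ofReal_norm, ENNReal.ofReal_lt_coe_iff (norm_nonneg y)]
      exact h1
    simpa using hρ.hasSum hy'
  refine ⟨δ, ⟨?_, by exact_mod_cast hδ0, ?_⟩⟩
  · refine FormalMultilinearSeries.le_radius_of_bound _ C fun k => ?_
    calc ‖qGammaSeries q p k‖ * (δ : ℝ) ^ k ≤ b ^ k * (C * a ^ k) * (δ : ℝ) ^ k := by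
          gcongr
          exact (norm_qGammaSeries_le q p k).trans (by gcongr; exact hp k)
      _ = C * (b * a * δ) ^ k := by rw [mul_pow, mul_pow]; ring
      _ ≤ C := mul_le_of_le_one_right hC.le
          (pow_le_one₀ (by positivity) (hδa.trans (by norm_num)))
  · intro y hy
    rw [zero_add]
    have hyδ : ‖y‖ < δ := by
      rw [mem_eball, edist_zero_right, ← ofReal_norm,
        ENNReal.ofReal_lt_coe_iff (norm_nonneg y)] at hy
      exact hy
    refine hasSum_qGamma q ha haδ hC.le hp hfs (by simpa using hyδ) (le_trans ?_ hδa)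
    gcongr

theorem analyticAt_qGamma (q : ℝ) {f : EuclideanSpace ℝ (Fin m) → Cl m}
    (hf : AnalyticAt ℝ f 0) : AnalyticAt ℝ (qGamma q f) 0 := by
  obtain ⟨p, hp⟩ := hf
  exact ⟨_, hasFPowerSeriesAt_qGamma q hp⟩

/-- The operator `q^Γ` preserves vanishing to second order at the origin. -/
theorem qGamma_isBigO_sq (q : ℝ) {f : EuclideanSpace ℝ (Fin m) → Cl m}
    (hf : AnalyticAt ℝ f 0) (h0 : f 0 = 0) (h1 : fderiv ℝ f 0 = 0) :
    f =O[𝓝 0] (fun x => ‖x‖ ^ 2) ∧ qGamma q f =O[𝓝 0] (fun x => ‖x‖ ^ 2) := by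
  obtain ⟨p, hp⟩ := hf
  have hp0 : p 0 = 0 := by
    ext v
    rw [hp.coeff_zero v, h0]
    rfl
  have hp1 : p 1 = 0 := by
    have h := hp.fderiv_eq
    rw [h1] at h
    exact (LinearIsometryEquiv.map_eq_zero_iff _).mp h.symm
  have key : ∀ {g : EuclideanSpace ℝ (Fin m) → Cl m}
      {s : FormalMultilinearSeries ℝ (EuclideanSpace ℝ (Fin m)) (Cl m)},
      HasFPowerSeriesAt g s 0 → s 0 = 0 → s 1 = 0 → g =O[𝓝 0] (fun x => ‖x‖ ^ 2) := by
    intro g s hg hs0 hs1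
    have h := hg.isBigO_sub_partialSum_pow 2
    simpa [FormalMultilinearSeries.partialSum, Finset.sum_range_succ, hs0, hs1] using h
  exact ⟨key hp hp0 hp1, key (hasFPowerSeriesAt_qGamma q hp) (qGammaSeries_eq_zero q hp0)
    (qGammaSeries_eq_zero q hp1)⟩

theorem Gam_zero_apply (f : EuclideanSpace ℝ (Fin m) → Cl m) : Gam f 0 = 0 := by
  simp [Gam_eq_sum_rot]

theorem qGamma_zero_apply (q : ℝ) (f : EuclideanSpace ℝ (Fin m) → Cl m) :
    qGamma q f 0 = f 0 := by
  rw [qGamma, tsum_eq_single 0]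
  · simp [qGammaTerm]
  · intro n hn
    obtain ⟨k, rfl⟩ := Nat.exists_eq_succ_of_ne_zero hn
    rw [qGammaTerm, Function.iterate_succ_apply', Gam_zero_apply, smul_zero]

/-! ### The q-Dirac operator -/

/-- The two brackets of the `q`-Dirac operator telescope. -/
theorem qDirac_eq (q : ℝ) (f : EuclideanSpace ℝ (Fin m) → Cl m) (x : EuclideanSpace ℝ (Fin m)) :
    qDirac q f x = (‖x‖ ^ 2)⁻¹ • (-(q - 1)⁻¹ • (vec x * (qGamma q f (q • x) - f x))) := by
  simp only [qDirac, qBracket, qEuler, vecInv]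
  rw [← smul_add, add_comm, sub_add_sub_cancel, inv_neg, smul_mul_assoc, mul_smul_comm]
  module

/-- Both `∂^q f` and `q^Γ ∂^q f` stay bounded at the origin: `∂^q f` is `|x|⁻²` times an analytic
function that vanishes to second order, and `|x|⁻²` commutes with `q^Γ`. -/
theorem exists_bound_qDirac (q : ℝ) {f : EuclideanSpace ℝ (Fin m) → Cl m}
    (hf : AnalyticAt ℝ f 0) :
    ∃ C δ : ℝ, 0 < δ ∧ ∀ x : EuclideanSpace ℝ (Fin m), x ≠ 0 → ‖x‖ < δ →
      ‖qDirac q f x‖ ≤ C ∧ ‖qGamma q (qDirac q f) x‖ ≤ C := by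
  let h : EuclideanSpace ℝ (Fin m) → Cl m := fun x => qGamma q f (q • x) - f x
  let H : EuclideanSpace ℝ (Fin m) → Cl m := fun x => -(q - 1)⁻¹ • (vec x * h x)
  have hD : qDirac q f = fun x => (‖x‖ ^ 2)⁻¹ • H x := funext (qDirac_eq q f)
  have hh : AnalyticAt ℝ h 0 := by
    have h1 : AnalyticAt ℝ (fun x : EuclideanSpace ℝ (Fin m) => qGamma q f (q • x)) 0 := by
      refine AnalyticAt.fun_comp (g := qGamma q f) (f := fun x => q • x) ?_
        ((q • ContinuousLinearMap.id ℝ (EuclideanSpace ℝ (Fin m))).analyticAt 0)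
      rw [smul_zero]
      exact analyticAt_qGamma q hf
    exact h1.sub hf
  have hh0 : h 0 = 0 := by simp [h, qGamma_zero_apply]
  have hvh : AnalyticAt ℝ (fun x => vec x * h x) 0 := analyticAt_mul (analyticAt_vec 0) hh
  have hH : AnalyticAt ℝ H 0 := hvh.const_smul (c := -(q - 1)⁻¹)
  have hH0 : H 0 = 0 := by simp [H, hh0]
  have hH1 : fderiv ℝ H 0 = 0 := by
    ext y : 1
    have h1 : fderiv ℝ H 0 = -(q - 1)⁻¹ • fderiv ℝ (fun x => vec x * h x) 0 :=
      fderiv_fun_const_smul hvh.differentiableAt _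
    have hv0 : (vec 0 : Cl m) = 0 := map_zero _
    rw [h1, _root_.smul_apply,
      fderiv_mul_apply (analyticAt_vec 0).differentiableAt hh.differentiableAt, hh0, hv0]
    simp
  obtain ⟨hO1, hO2⟩ := qGamma_isBigO_sq q hH hH0 hH1
  obtain ⟨C₁, hC₁⟩ := hO1.bound
  obtain ⟨C₂, hC₂⟩ := hO2.bound
  obtain ⟨δ, hδ, hball⟩ := Metric.eventually_nhds_iff_ball.mp
    ((hC₁.and hC₂).and hH.eventually_analyticAt)
  refine ⟨max C₁ C₂, δ, hδ, fun x hx hxδ => ?_⟩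
  have hx2 : 0 < ‖x‖ ^ 2 := by positivity
  obtain ⟨⟨hb1, hb2⟩, -⟩ := hball x (by simpa using hxδ)
  have hscale : ∀ {v : Cl m} {C : ℝ}, ‖v‖ ≤ C * ‖‖x‖ ^ 2‖ → ‖(‖x‖ ^ 2)⁻¹ • v‖ ≤ C := by
    intro v C hv
    rw [Real.norm_of_nonneg hx2.le] at hv
    rw [norm_smul, norm_inv, Real.norm_of_nonneg hx2.le, inv_mul_le_iff₀ hx2]
    linarith
  refine ⟨?_, ?_⟩
  · rw [hD]
    exact (hscale hb1).trans (le_max_left _ _)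
  · have hU : IsOpen (ball (0 : EuclideanSpace ℝ (Fin m)) δ \ {0}) :=
      isOpen_ball.sdiff isClosed_singleton
    have hqG : qGamma q (qDirac q f) x = (‖x‖ ^ 2)⁻¹ • qGamma q H x := by
      rw [qGamma, qGamma, ← tsum_const_smul'' (‖x‖ ^ 2)⁻¹]
      refine tsum_congr fun n => ?_
      rw [qGammaTerm, qGammaTerm, hD, smul_comm]
      congr 1
      exact Gam_iterate_norm_sq_inv_smul hU (by simp) (fun y hy => (hball y hy.1).2) n x
        ⟨by simpa using hxδ, hx⟩
    rw [hqG]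
    exact (hscale hb2).trans (le_max_right _ _)

theorem continuous_qDirac_sphere {q r : ℝ} (hq : 0 ≤ q) (hr : 0 ≤ r)
    {g : EuclideanSpace ℝ (Fin m) → Cl m} (hg : ContinuousOn g (sphere 0 r))
    (hQ : QGammaRegular q g (q * r)) :
    Continuous fun ξ : sphere (0 : EuclideanSpace ℝ (Fin m)) 1 => qDirac q g (r • ξ.1) := by
  have hn : ∀ ξ : sphere (0 : EuclideanSpace ℝ (Fin m)) 1, ‖r • ξ.1‖ = r := fun ξ =>
    mem_sphere_zero_iff_norm.mp (smul_mem_sphere hr ξ)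
  have hc := continuous_comp_smul_sphere (mul_nonneg hq hr) hQ.continuousOn
  simp only [qDirac_eq, hn, smul_smul q r]
  have hv : Continuous fun ξ : sphere (0 : EuclideanSpace ℝ (Fin m)) 1 =>
      (vec (r • ξ.1) : Cl m) := continuous_vec.comp (by fun_prop)
  exact ((hv.mul (hc.sub (continuous_comp_smul_sphere hr hg))).const_smul
    (-(q - 1)⁻¹)).const_smul (r ^ 2)⁻¹

/-! ### The q-integral as a sum of sphere integrals -/

/-- A function that is continuous on the spheres of radii `R q^k` and bounded near the origin is
bounded uniformly over these spheres: only finitely many of them are far from the origin. -/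
theorem exists_bound_of_bound_near_zero {q R : ℝ} (hq0 : 0 < q) (hq1 : q < 1) (hR : 0 < R)
    {F : EuclideanSpace ℝ (Fin m) → Cl m}
    (hF : ∀ k : ℕ, Continuous fun ξ : sphere (0 : EuclideanSpace ℝ (Fin m)) 1 =>
      F ((R * q ^ k) • ξ.1))
    (hb : ∃ C δ : ℝ, 0 < δ ∧ ∀ x : EuclideanSpace ℝ (Fin m), x ≠ 0 → ‖x‖ < δ → ‖F x‖ ≤ C) :
    ∃ B : ℝ, ∀ (k : ℕ) (ξ : sphere (0 : EuclideanSpace ℝ (Fin m)) 1),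
      ‖F ((R * q ^ k) • ξ.1)‖ ≤ B := by
  obtain ⟨C, δ, hδ, hC⟩ := hb
  have hlim : Filter.Tendsto (fun k : ℕ => R * q ^ k) Filter.atTop (𝓝 0) := by
    simpa using (tendsto_pow_atTop_nhds_zero_of_lt_one hq0.le hq1).const_mul R
  obtain ⟨k₀, hk₀⟩ := Filter.eventually_atTop.mp (hlim.eventually (gt_mem_nhds hδ))
  have hbd : ∀ k : ℕ, ∃ b : ℝ, ∀ ξ : sphere (0 : EuclideanSpace ℝ (Fin m)) 1,
      ‖F ((R * q ^ k) • ξ.1)‖ ≤ b := by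
    intro k
    obtain ⟨b, hb⟩ := isCompact_univ.exists_bound_of_continuousOn (hF k).continuousOn
    exact ⟨b, fun ξ => hb ξ (Set.mem_univ ξ)⟩
  choose b hb using hbd
  refine ⟨|C| + ∑ k ∈ Finset.range k₀, |b k|, fun k ξ => ?_⟩
  rcases lt_or_ge k k₀ with hk | hk
  · refine ((hb k ξ).trans (le_abs_self _)).trans
      ((Finset.single_le_sum (f := fun k => |b k|) (fun _ _ => abs_nonneg _)
        (Finset.mem_range.mpr hk)).trans ?_)
    exact le_add_of_nonneg_left (abs_nonneg C)
  · have hr : 0 < R * q ^ k := by positivity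
    have hn : ‖(R * q ^ k) • ξ.1‖ = R * q ^ k :=
      mem_sphere_zero_iff_norm.mp (smul_mem_sphere hr.le ξ)
    refine (hC _ (norm_ne_zero_iff.mp (by rw [hn]; exact hr.ne'))
      (by rw [hn]; exact hk₀ k hk)).trans ((le_abs_self C).trans ?_)
    exact le_add_of_nonneg_right (Finset.sum_nonneg fun _ _ => abs_nonneg _)

/-- For a function bounded on the spheres of radii `R q^k`, the Jackson series is dominated by a
geometric series, so that it may be interchanged with the integral over the unit sphere. -/
theorem qIntegrable_and_hasSum {q R : ℝ} (hm : 1 ≤ m) (hq0 : 0 < q) (hq1 : q < 1) (hR : 0 < R)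
    {F : EuclideanSpace ℝ (Fin m) → Cl m}
    (hF : ∀ k : ℕ, Continuous fun ξ : sphere (0 : EuclideanSpace ℝ (Fin m)) 1 =>
      F ((R * q ^ k) • ξ.1))
    {B : ℝ} (hB : ∀ (k : ℕ) (ξ : sphere (0 : EuclideanSpace ℝ (Fin m)) 1),
      ‖F ((R * q ^ k) • ξ.1)‖ ≤ B) :
    QIntegrable q R F ∧ HasSum (fun k : ℕ => ((1 - q) * (R * q ^ k) ^ m) •
      ∫ ξ, F ((R * q ^ k) • ξ.1) ∂sphereMeasure m) (qIntegral q R F) := by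
  let T : ℕ → sphere (0 : EuclideanSpace ℝ (Fin m)) 1 → Cl m := fun k ξ =>
    q ^ k • ((R * q ^ k) ^ (m - 1) • F ((R * q ^ k) • ξ.1))
  have hTc : ∀ k, Continuous (T k) := fun k =>
    ((hF k).const_smul ((R * q ^ k) ^ (m - 1))).const_smul (q ^ k)
  have hu : Summable fun k : ℕ => q ^ k * (R ^ (m - 1) * B) :=
    (summable_geometric_of_lt_one hq0.le hq1).mul_right _
  have hTu : ∀ k ξ, ‖T k ξ‖ ≤ q ^ k * (R ^ (m - 1) * B) := by
    intro k ξ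
    have hB0 : 0 ≤ B := (norm_nonneg _).trans (hB k ξ)
    have hRk : R * q ^ k ≤ R := mul_le_of_le_one_right hR.le (pow_le_one₀ hq0.le hq1.le)
    simp only [T]
    rw [norm_smul, norm_smul, norm_pow, norm_pow, Real.norm_of_nonneg hq0.le,
      Real.norm_of_nonneg (by positivity : 0 ≤ R * q ^ k)]
    gcongr
    exact hB k ξ
  have hTs : ∀ ξ, Summable fun k => T k ξ := fun ξ =>
    Summable.of_norm_bounded hu fun k => hTu k ξ
  have hTt : Continuous fun ξ => ∑' k, T k ξ := continuous_tsum hTc hu hTu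
  refine ⟨⟨hTs, integrable_sphere_of_continuous (hTt.const_smul ((1 - q) * R))⟩, ?_⟩
  have hsum := hasSum_integral_sphere hTc (B := ∑' k : ℕ, q ^ k * (R ^ (m - 1) * B))
    fun ξ s => (Finset.sum_le_sum fun k _ => hTu k ξ).trans
      (hu.sum_le_tsum s fun k _ => (norm_nonneg _).trans (hTu k ξ))
  have hq : qIntegral q R F = ((1 - q) * R) • ∫ ξ, ∑' k, T k ξ ∂sphereMeasure m := by
    rw [← integral_smul]
    rfl
  rw [hq]
  convert hsum.const_smul ((1 - q) * R) using 2 with k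
  simp only [T]
  rw [integral_smul, integral_smul, smul_smul, smul_smul]
  congr 1
  obtain ⟨n, rfl⟩ : ∃ n, m = n + 1 := ⟨m - 1, by omega⟩
  rw [Nat.add_sub_cancel, pow_succ]
  ring

/-! ### Telescoping -/

/-- The boundary pairing `r^{m-2} ∫ \bar f x g` over the sphere of radius `r`. The power
`r^{m-2}` is encoded as `r^{m-1} r⁻¹`, which is right for `m = 1` as well. -/
def boundaryPairing (f g : EuclideanSpace ℝ (Fin m) → Cl m) (r : ℝ) : Cl m :=
  (r ^ (m - 1) * r⁻¹) •
    ∫ ξ, star (f (r • ξ.1)) * (vec (r • ξ.1) * g (r • ξ.1)) ∂sphereMeasure m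

/-- One term of the `q`-integral is a difference of boundary pairings: `q^Γ` is moved from
`∂^q f` to `g`, the mixed products cancel, and the rest is evaluated through
`∫ \bar{q^Γ f} x q^Γ g = q^{m-1} ∫ \bar f x g`. -/
theorem integral_integrand_eq_sub {q r : ℝ} (hm : 1 ≤ m) (hq0 : 0 < q) (hq1 : q < 1) (hr : 0 < r)
    {f g : EuclideanSpace ℝ (Fin m) → Cl m} (hf : ContinuousOn f (sphere 0 r))
    (hg : ContinuousOn g (sphere 0 r)) (hQf : QGammaRegular q f (q * r))
    (hQg : QGammaRegular q g (q * r)) (hQD : QGammaRegular q (qDirac q f) r) :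
    ((1 - q) * r ^ m) • ∫ ξ, (star (qGamma q (qDirac q f) (r • ξ.1)) * g (q • r • ξ.1)
        - star (f (r • ξ.1)) * qDirac q g (r • ξ.1)) ∂sphereMeasure m
      = boundaryPairing f g r - boundaryPairing f g (q * r) := by
  have hqr : 0 < q * r := mul_pos hq0 hr
  have hgq : QGammaRegular q (fun y => g (q • y)) r := hQg.comp_smul hq0.le
  have cf := continuous_comp_smul_sphere hr.le hf
  have cg := continuous_comp_smul_sphere hr.le hg
  have cgq := continuous_comp_smul_sphere hr.le hgq.analyticOnNhd.continuousOn
  have cD := continuous_comp_smul_sphere hr.le hQD.analyticOnNhd.continuousOn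
  have cQD := continuous_comp_smul_sphere hr.le hQD.continuousOn
  have cDg := continuous_qDirac_sphere hq0.le hr.le hg hQg
  have cQf := continuous_comp_smul_sphere hqr.le hQf.continuousOn
  have cQg := continuous_comp_smul_sphere hqr.le hQg.continuousOn
  have cv : ∀ t : ℝ, Continuous fun ξ : sphere (0 : EuclideanSpace ℝ (Fin m)) 1 =>
      (vec (t • ξ.1) : Cl m) := fun t => continuous_vec.comp (by fun_prop)
  have i1 := integrable_sphere_of_continuous (cQD.star.mul cgq)
  have i2 := integrable_sphere_of_continuous (cf.star.mul cDg)
  have hadj : ∫ ξ, star (qGamma q (qDirac q f) (r • ξ.1)) * g (q • r • ξ.1) ∂sphereMeasure m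
      = ∫ ξ, star (qDirac q f (r • ξ.1)) * qGamma q g ((q * r) • ξ.1) ∂sphereMeasure m := by
    rw [integral_star_qGamma_mul (v := fun y => g (q • y)) hr.le hQD hgq]
    simp only [qGamma_comp_smul, smul_smul q r]
  have i3 := integrable_sphere_of_continuous (cD.star.mul cQg)
  have hcomb : ∫ ξ, (star (qGamma q (qDirac q f) (r • ξ.1)) * g (q • r • ξ.1)
        - star (f (r • ξ.1)) * qDirac q g (r • ξ.1)) ∂sphereMeasure m
      = ∫ ξ, (star (qDirac q f (r • ξ.1)) * qGamma q g ((q * r) • ξ.1)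
        - star (f (r • ξ.1)) * qDirac q g (r • ξ.1)) ∂sphereMeasure m := by
    refine (integral_sub i1 i2).trans (Eq.trans ?_ (integral_sub i3 i2).symm)
    exact congrArg (· - _) hadj
  have hpt : ∀ ξ : sphere (0 : EuclideanSpace ℝ (Fin m)) 1,
      ((1 - q) * r ^ m) • (star (qDirac q f (r • ξ.1)) * qGamma q g ((q * r) • ξ.1)
        - star (f (r • ξ.1)) * qDirac q g (r • ξ.1))
      = (r ^ (m - 1) * r⁻¹) • (star (f (r • ξ.1)) * (vec (r • ξ.1) * g (r • ξ.1)))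
        - (r ^ (m - 1) * (q * r)⁻¹) • (star (qGamma q f ((q * r) • ξ.1)) *
          (vec ((q * r) • ξ.1) * qGamma q g ((q * r) • ξ.1))) := by
    intro ξ
    have hn : ‖r • ξ.1‖ = r := mem_sphere_zero_iff_norm.mp (smul_mem_sphere hr.le ξ)
    have hvq : (vec ((q * r) • ξ.1) : Cl m) = q • vec (r • ξ.1) := by
      rw [mul_smul, vec_smul]
    have h1q : 1 - q ≠ 0 := (sub_pos.mpr hq1).ne'
    have hcoef : (1 - q) * r ^ m * ((r ^ 2)⁻¹ * -(q - 1)⁻¹) = r ^ (m - 1) * r⁻¹ := by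
      obtain ⟨n, rfl⟩ : ∃ n, m = n + 1 := ⟨m - 1, by omega⟩
      rw [Nat.add_sub_cancel, ← inv_neg, neg_sub]
      field_simp
      ring
    have hcoef' : r ^ (m - 1) * (q * r)⁻¹ * q = r ^ (m - 1) * r⁻¹ := by
      field_simp
    rw [qDirac_eq, qDirac_eq, hn, smul_smul q r, hvq]
    simp only [CliffordAlgebra.star_smul, star_mul, star_vec, star_sub, smul_mul_assoc,
      mul_smul_comm, smul_smul, ← smul_sub, hcoef, hcoef']
    congr 1
    simp only [mul_sub, sub_mul, mul_neg, neg_mul, mul_assoc]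
    abel
  have i4 := integrable_sphere_of_continuous ((cf.star.mul ((cv r).mul cg)).const_smul
    (r ^ (m - 1) * r⁻¹))
  have i5 := integrable_sphere_of_continuous ((cQf.star.mul ((cv (q * r)).mul cQg)).const_smul
    (r ^ (m - 1) * (q * r)⁻¹))
  rw [hcomb, ← integral_smul, integral_congr_ae (Filter.Eventually.of_forall hpt)]
  refine (integral_sub i4 i5).trans ?_
  have e4 := integral_smul (μ := sphereMeasure m) (r ^ (m - 1) * r⁻¹)
    fun ξ : sphere (0 : EuclideanSpace ℝ (Fin m)) 1 =>
      star (f (r • ξ.1)) * (vec (r • ξ.1) * g (r • ξ.1))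
  have e5 := integral_smul (μ := sphereMeasure m) (r ^ (m - 1) * (q * r)⁻¹)
    fun ξ : sphere (0 : EuclideanSpace ℝ (Fin m)) 1 =>
      star (qGamma q f ((q * r) • ξ.1)) * (vec ((q * r) • ξ.1) * qGamma q g ((q * r) • ξ.1))
  refine congrArg₂ (· - ·) e4 (e5.trans ?_)
  rw [integral_star_qGamma_mul_vec_mul_qGamma hq0 hm hqr.le hQf hQg, smul_smul, boundaryPairing]
  congr 1
  rw [mul_pow]
  ring

theorem boundaryPairing_eq_smul_integral {r : ℝ} (hr : 0 < r)
    (f g : EuclideanSpace ℝ (Fin m) → Cl m) :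
    boundaryPairing f g r = r ^ (m - 1) •
      ∫ ξ, star (f (r • ξ.1)) * (vec ξ.1 * g (r • ξ.1)) ∂sphereMeasure m := by
  simp only [boundaryPairing, vec_smul, smul_mul_assoc, mul_smul_comm]
  rw [integral_smul, smul_smul, mul_assoc, inv_mul_cancel₀ hr.ne', mul_one]

/-- The boundary pairings tend to zero: for `m ≥ 2` because of the factor `r^{m-1}`, and in every
dimension because the vector variable has mean zero over the unit sphere. -/
theorem tendsto_boundaryPairing {q R : ℝ} (hq0 : 0 < q) (hq1 : q < 1) (hR : 0 < R)
    {f g : EuclideanSpace ℝ (Fin m) → Cl m} (hf : ContinuousOn f (closedBall 0 R))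
    (hg : ContinuousOn g (closedBall 0 R)) :
    Filter.Tendsto (fun k : ℕ => boundaryPairing f g (R * q ^ k)) Filter.atTop (𝓝 0) := by
  obtain ⟨M, hM, hmul⟩ := exists_norm_mul_le m
  obtain ⟨S, hS, hstar⟩ := exists_norm_star_le m
  have hcomp := isCompact_closedBall (0 : EuclideanSpace ℝ (Fin m)) R
  obtain ⟨Cf, hCf⟩ := hcomp.exists_bound_of_continuousOn hf
  obtain ⟨Cg, hCg⟩ := hcomp.exists_bound_of_continuousOn hg
  have hrpos : ∀ k : ℕ, 0 < R * q ^ k := fun k => by positivity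
  have hlim : Filter.Tendsto (fun k : ℕ => R * q ^ k) Filter.atTop (𝓝 0) := by
    simpa using (tendsto_pow_atTop_nhds_zero_of_lt_one hq0.le hq1).const_mul R
  have hmem : ∀ (k : ℕ) (ξ : sphere (0 : EuclideanSpace ℝ (Fin m)) 1),
      (R * q ^ k) • ξ.1 ∈ closedBall (0 : EuclideanSpace ℝ (Fin m)) R := by
    intro k ξ
    rw [mem_closedBall_zero_iff, mem_sphere_zero_iff_norm.mp (smul_mem_sphere (hrpos k).le ξ)]
    exact mul_le_of_le_one_right hR.le (pow_le_one₀ hq0.le hq1.le)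
  have hcont : ∀ {h : EuclideanSpace ℝ (Fin m) → Cl m}, ContinuousOn h (closedBall 0 R) →
      ∀ k : ℕ, Continuous fun ξ : sphere (0 : EuclideanSpace ℝ (Fin m)) 1 =>
        h ((R * q ^ k) • ξ.1) := fun hh k => hh.comp_continuous (by fun_prop) (hmem k)
  have hzero : ∀ {h : EuclideanSpace ℝ (Fin m) → Cl m}, ContinuousOn h (closedBall 0 R) →
      ∀ ξ : sphere (0 : EuclideanSpace ℝ (Fin m)) 1,
        Filter.Tendsto (fun k : ℕ => h ((R * q ^ k) • ξ.1)) Filter.atTop (𝓝 (h 0)) := by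
    intro h hh ξ
    have hc : ContinuousAt h 0 := hh.continuousAt (closedBall_mem_nhds 0 hR)
    have h1 := hlim.smul_const ξ.1
    rw [zero_smul] at h1
    exact hc.tendsto.comp h1
  have hint : Filter.Tendsto (fun k : ℕ => ∫ ξ, star (f ((R * q ^ k) • ξ.1)) *
      (vec ξ.1 * g ((R * q ^ k) • ξ.1)) ∂sphereMeasure m) Filter.atTop
      (𝓝 (∫ ξ, star (f 0) * (vec ξ.1 * g 0) ∂sphereMeasure m)) := by
    refine tendsto_integral_of_dominated_convergence
      (fun ξ => M * (S * Cf) * (M * ‖(vec ξ.1 : Cl m)‖ * Cg)) (fun k => ?_) ?_ (fun k => ?_) ?_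
    · exact ((hcont hf k).star.mul ((continuous_vec.comp continuous_subtype_val).mul
        (hcont hg k))).aestronglyMeasurable
    · have hc : Continuous fun ξ : sphere (0 : EuclideanSpace ℝ (Fin m)) 1 =>
          M * (S * Cf) * (M * ‖(vec ξ.1 : Cl m)‖ * Cg) := by fun_prop
      exact hc.integrable_of_hasCompactSupport (HasCompactSupport.of_compactSpace _)
    · refine Filter.Eventually.of_forall fun ξ => (hmul _ _).trans ?_
      have h1 := (hstar (f ((R * q ^ k) • ξ.1))).trans
        (mul_le_mul_of_nonneg_left (hCf _ (hmem k ξ)) hS)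
      have h2 := (hmul (vec ξ.1) (g ((R * q ^ k) • ξ.1))).trans
        (mul_le_mul_of_nonneg_left (hCg _ (hmem k ξ)) (mul_nonneg hM (norm_nonneg _)))
      exact mul_le_mul (mul_le_mul_of_nonneg_left h1 hM) h2 (norm_nonneg _)
        (mul_nonneg hM ((norm_nonneg _).trans h1))
    · exact Filter.Eventually.of_forall fun ξ =>
        (hzero hf ξ).star.mul (tendsto_const_nhds.mul (hzero hg ξ))
  have hmean : ∫ ξ, star (f 0) * (vec ξ.1 * g 0) ∂sphereMeasure m = 0 := by
    have h := ((mulCLM m (star (f 0))).comp ((mulCLM m).flip (g 0))).integral_comp_comm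
      (integrable_sphere_of_continuous
        ((continuous_vec (m := m)).comp continuous_subtype_val))
    refine h.trans ?_
    have h0 : ∫ ξ, (vec ∘ Subtype.val) ξ ∂sphereMeasure m = (0 : Cl m) := integral_vec_sphere
    rw [h0, map_zero]
  rw [hmean] at hint
  have h := (hlim.pow (m - 1)).smul hint
  rw [smul_zero] at h
  exact h.congr fun k => (boundaryPairing_eq_smul_integral (hrpos k) f g).symm

theorem boundaryPairing_eq_sphereIntegral {r : ℝ} (hm : 1 ≤ m) (hr : 0 < r)
    (f g : EuclideanSpace ℝ (Fin m) → Cl m) :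
    boundaryPairing f g r
      = r ^ ((m : ℤ) - 2) • sphereIntegral r (fun x => star (f x) * vec x * g x) := by
  have h : r ^ (m - 1) * r⁻¹ = r ^ ((m : ℤ) - 2) := by
    obtain ⟨n, rfl⟩ : ∃ n, m = n + 1 := ⟨m - 1, by omega⟩
    rw [Nat.add_sub_cancel, show ((n + 1 : ℕ) : ℤ) - 2 = (n : ℤ) - 1 by push_cast; ring,
      zpow_sub_one₀ hr.ne', zpow_natCast]
  simp only [boundaryPairing, sphereIntegral, h, mul_assoc]

/-- The `q`-Cauchy formula, with both the existence of the `q`-integral and its value. -/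
theorem qCauchy {q R : ℝ} (hm : 1 ≤ m) (hq0 : 0 < q) (hq1 : q < 1) (hR : 0 < R)
    {f g : EuclideanSpace ℝ (Fin m) → Cl m} (hf : AnalyticOnNhd ℝ f (closedBall 0 R))
    (hg : AnalyticOnNhd ℝ g (closedBall 0 R))
    (hQf : ∀ k : ℕ, QGammaDefinedOn q f (sphere 0 (R * q ^ (k + 1))))
    (hQg : ∀ k : ℕ, QGammaDefinedOn q g (sphere 0 (R * q ^ (k + 1))))
    (hQD : ∀ k : ℕ, QGammaDefinedOn q (qDirac q f) (sphere 0 (R * q ^ k))) :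
    QIntegrable q R (fun x =>
        star (qGamma q (qDirac q f) x) * g (q • x) - star (f x) * qDirac q g x) ∧
      qIntegral q R (fun x =>
        star (qGamma q (qDirac q f) x) * g (q • x) - star (f x) * qDirac q g x)
        = R ^ ((m : ℤ) - 2) • sphereIntegral R (fun x => star (f x) * vec x * g x) := by
  have hrpos : ∀ k : ℕ, 0 < R * q ^ k := fun k => by positivity
  have hstep : ∀ k : ℕ, R * q ^ (k + 1) = q * (R * q ^ k) := fun k => by ring
  have hsub : ∀ k : ℕ, sphere (0 : EuclideanSpace ℝ (Fin m)) (R * q ^ k) ⊆ closedBall 0 R :=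
    fun k => sphere_subset_closedBall.trans (closedBall_subset_closedBall
      (mul_le_of_le_one_right hR.le (pow_le_one₀ hq0.le hq1.le)))
  have rf : ∀ k : ℕ, QGammaRegular q f (q * (R * q ^ k)) := fun k =>
    hstep k ▸ (hQf k).regular
  have rg : ∀ k : ℕ, QGammaRegular q g (q * (R * q ^ k)) := fun k =>
    hstep k ▸ (hQg k).regular
  have rD : ∀ k : ℕ, QGammaRegular q (qDirac q f) (R * q ^ k) := fun k => (hQD k).regular
  have cf : ∀ k : ℕ, ContinuousOn f (sphere 0 (R * q ^ k)) := fun k =>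
    hf.continuousOn.mono (hsub k)
  have cg : ∀ k : ℕ, ContinuousOn g (sphere 0 (R * q ^ k)) := fun k =>
    hg.continuousOn.mono (hsub k)
  have h0 : (0 : EuclideanSpace ℝ (Fin m)) ∈ closedBall (0 : EuclideanSpace ℝ (Fin m)) R :=
    mem_closedBall_self hR.le
  set F : EuclideanSpace ℝ (Fin m) → Cl m := fun x =>
    star (qGamma q (qDirac q f) x) * g (q • x) - star (f x) * qDirac q g x with hFdef
  have hFc : ∀ k : ℕ, Continuous fun ξ : sphere (0 : EuclideanSpace ℝ (Fin m)) 1 =>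
      F ((R * q ^ k) • ξ.1) := fun k =>
    ((continuous_comp_smul_sphere (hrpos k).le (rD k).continuousOn).star.mul
      (continuous_comp_smul_sphere (hrpos k).le (f := fun y => g (q • y))
        ((rg k).comp_smul hq0.le).analyticOnNhd.continuousOn)).sub
      ((continuous_comp_smul_sphere (hrpos k).le (cf k)).star.mul
        (continuous_qDirac_sphere hq0.le (hrpos k).le (cg k) (rg k)))
  have hFb : ∃ C δ : ℝ, 0 < δ ∧ ∀ x : EuclideanSpace ℝ (Fin m), x ≠ 0 → ‖x‖ < δ →
      ‖F x‖ ≤ C := by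
    obtain ⟨M, hM, hmul⟩ := exists_norm_mul_le m
    obtain ⟨S, hS, hstar⟩ := exists_norm_star_le m
    have hcomp := isCompact_closedBall (0 : EuclideanSpace ℝ (Fin m)) R
    obtain ⟨Cf, hCf⟩ := hcomp.exists_bound_of_continuousOn hf.continuousOn
    obtain ⟨Cg, hCg⟩ := hcomp.exists_bound_of_continuousOn hg.continuousOn
    obtain ⟨C₁, δ₁, hδ₁, h₁⟩ := exists_bound_qDirac q (hf 0 h0)
    obtain ⟨C₂, δ₂, hδ₂, h₂⟩ := exists_bound_qDirac q (hg 0 h0)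
    refine ⟨M * (S * C₁) * Cg + M * (S * Cf) * C₂, min R (min δ₁ δ₂),
      lt_min hR (lt_min hδ₁ hδ₂), fun x hx hxδ => ?_⟩
    have hxR : ‖x‖ < R := hxδ.trans_le (min_le_left _ _)
    have hx₁ := (h₁ x hx (hxδ.trans_le ((min_le_right _ _).trans (min_le_left _ _)))).2
    have hx₂ := (h₂ x hx (hxδ.trans_le ((min_le_right _ _).trans (min_le_right _ _)))).1
    have hxf := hCf x (mem_closedBall_zero_iff.mpr hxR.le)
    have hxg := hCg (q • x) (by
      rw [mem_closedBall_zero_iff, norm_smul, Real.norm_of_nonneg hq0.le]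
      exact (mul_le_of_le_one_left (norm_nonneg x) hq1.le).trans hxR.le)
    have key : ∀ {a b : Cl m} {A B : ℝ}, ‖a‖ ≤ A → ‖b‖ ≤ B → ‖star a * b‖ ≤ M * (S * A) * B := by
      intro a b A B ha hb
      have h1 := (hstar a).trans (mul_le_mul_of_nonneg_left ha hS)
      exact (hmul _ _).trans (mul_le_mul (mul_le_mul_of_nonneg_left h1 hM) hb (norm_nonneg _)
        (mul_nonneg hM ((norm_nonneg _).trans h1)))
    exact (norm_sub_le _ _).trans (add_le_add (key hx₁ hxg) (key hxf hx₂))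
  obtain ⟨B, hB⟩ := exists_bound_of_bound_near_zero hq0 hq1 hR hFc hFb
  obtain ⟨hI, hS⟩ := qIntegrable_and_hasSum hm hq0 hq1 hR hFc hB
  refine ⟨hI, ?_⟩
  have hterm : ∀ k : ℕ, ((1 - q) * (R * q ^ k) ^ m) •
      ∫ ξ, F ((R * q ^ k) • ξ.1) ∂sphereMeasure m
      = boundaryPairing f g (R * q ^ k) - boundaryPairing f g (R * q ^ (k + 1)) := by
    intro k
    rw [hstep k]
    exact integral_integrand_eq_sub hm hq0 hq1 (hrpos k) (cf k) (cg k) (rf k) (rg k) (rD k)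
  simp only [hterm] at hS
  have hpart := hS.tendsto_sum_nat
  simp only [Finset.sum_range_sub'] at hpart
  have hlim := (tendsto_boundaryPairing hq0 hq1 hR hf.continuousOn hg.continuousOn).const_sub
    (boundaryPairing f g (R * q ^ 0))
  rw [tendsto_nhds_unique hpart hlim, sub_zero, pow_zero, mul_one,
    boundaryPairing_eq_sphereIntegral hm hR]

/-! ### Constant functions -/

theorem qGamma_const (q : ℝ) (c : Cl m) :
    qGamma q (fun _ : EuclideanSpace ℝ (Fin m) => c) = fun _ => c := by
  funext x
  rw [qGamma, tsum_eq_single 0]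
  · simp [qGammaTerm]
  · intro n hn
    obtain ⟨k, rfl⟩ := Nat.exists_eq_succ_of_ne_zero hn
    rw [qGammaTerm, Nat.succ_eq_add_one, Gam_iterate_succ_const, smul_zero]

theorem qGammaDefinedOn_const (q : ℝ) (c : Cl m) (A : Set (EuclideanSpace ℝ (Fin m))) :
    QGammaDefinedOn q (fun _ => c) A := by
  refine ⟨analyticOnNhd_const, (HasSumUniformlyOn.of_norm_le_summable
    (u := fun n => if n = 0 then ‖c‖ else 0)
    (hasSum_ite_eq 0 ‖c‖).summable fun n x _ => ?_).summableUniformlyOn⟩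
  rcases n with _ | n
  · simp [qGammaTerm]
  · rw [qGammaTerm, Gam_iterate_succ_const]
    simp

theorem qDirac_const (q : ℝ) (c : Cl m) :
    qDirac q (fun _ : EuclideanSpace ℝ (Fin m) => c) = fun _ => 0 := by
  funext x
  rw [qDirac_eq, qGamma_const]
  simp

end QClifford

end

theorem mainTheorem2 (m : ℕ) (hm : 1 ≤ m) (q R : ℝ) (hq0 : 0 < q) (hq1 : q < 1) (hR : 0 < R) :
    (∀ f g : EuclideanSpace ℝ (Fin m) → QClifford.Cl m,
      AnalyticOnNhd ℝ f (Metric.closedBall 0 R) →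
      AnalyticOnNhd ℝ g (Metric.closedBall 0 R) →
      (∀ k : ℕ, QClifford.QGammaDefinedOn q f (Metric.sphere 0 (R * q ^ (k + 1)))) →
      (∀ k : ℕ, QClifford.QGammaDefinedOn q g (Metric.sphere 0 (R * q ^ (k + 1)))) →
      (∀ k : ℕ, QClifford.QGammaDefinedOn q (QClifford.qDirac q f)
        (Metric.sphere 0 (R * q ^ k))) →
      QClifford.QIntegrable q R (fun x =>
        star (QClifford.qGamma q (QClifford.qDirac q f) x) * g (q • x)
          - star (f x) * QClifford.qDirac q g x) ∧
      QClifford.qIntegral q R (fun x =>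
        star (QClifford.qGamma q (QClifford.qDirac q f) x) * g (q • x)
          - star (f x) * QClifford.qDirac q g x)
        = R ^ ((m : ℤ) - 2) •
          QClifford.sphereIntegral R (fun x => star (f x) * QClifford.vec x * g x)) ∧
    (∀ g : EuclideanSpace ℝ (Fin m) → QClifford.Cl m,
      AnalyticOnNhd ℝ g (Metric.closedBall 0 R) →
      (∀ k : ℕ, QClifford.QGammaDefinedOn q g (Metric.sphere 0 (R * q ^ (k + 1)))) →
      QClifford.QIntegrable q R (QClifford.qDirac q g) ∧
      QClifford.qIntegral q R (QClifford.qDirac q g)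
        = -(R ^ ((m : ℤ) - 2) •
          QClifford.sphereIntegral R (fun x => QClifford.vec x * g x))) := by
  refine ⟨fun f g hf hg hQf hQg hQD =>
    QClifford.qCauchy hm hq0 hq1 hR hf hg hQf hQg hQD, fun g hg hQg => ?_⟩
  -- the second formula is the first one for `f = -1`, for which `∂^q f = 0`
  have h := QClifford.qCauchy hm hq0 hq1 hR (f := fun _ => -1) (g := g) analyticOnNhd_const hg
    (fun k => QClifford.qGammaDefinedOn_const q _ _) hQg
    (fun k => by
      rw [QClifford.qDirac_const]
      exact QClifford.qGammaDefinedOn_const q _ _)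
  rw [QClifford.qDirac_const, QClifford.qGamma_const] at h
  simp only [star_zero, zero_mul, star_neg, star_one, neg_mul, one_mul, sub_neg_eq_add,
    zero_add] at h
  refine ⟨h.1, h.2.trans ?_⟩
  rw [← smul_neg]
  congr 1
  exact MeasureTheory.integral_neg _
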